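/- Let $\mathbb{K}$ be a field and $N\ge 1$. Let $A=\mathbb{K}[X_1][X_2;\sigma_2,\delta_2]\cdots[X_N;\sigma_N,\delta_N]$ be an iterated Ore extension, put $A_i=\mathbb{K}[X_1]\cdots[X_i;\sigma_i,\delta_i]$ (so $A_0=\mathbb K$, $A_N=A$), where $\sigma_i$ is a $\mathbb{K}$-algebra automorphism of $A_{i-1}$ and $\delta_i$ is a $\mathbb K$-linear (left) $\sigma_i$-derivation of $A_{i-1}$, such that: 1. $\sigma_i(X_l)=\lambda_{i,l}X_l$ for $1\le l<i\le N$, where $\lambda_{i,l}\in\mathbb{K}^*$ and $\lambda_{i,l}=\lambda_{l,i}^{-1}$ for all $1\le i,l\le N$; 2. for $2\le i\le N$ there is $q_i\in\mathbb{K}^*$, $q_i\neq 1$, with $\delta_i\sigma_i=q_i\sigma_i\delta_i$; 3. for $2\le i\le N$, $\delta_i$ extends to a locally nilpotent, iterative higher $q_i$-skew $\sigma_i$-derivation $\{d_{i,n}\}_{n\ge 0}$ on $A_{i-1}$: the $d_{i,n}$ are $\mathbb{K}$-linear operators with $d_{i,0}=\mathrm{id}$, $d_{i,1}=\delta_i$,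 $d_{i,n}(rs)=\sum_{k=0}^n\sigma_i^{n-k}d_{i,k}(r)\,d_{i,n-k}(s)$, $d_{i,n}\sigma_i=q_i^n\sigma_i d_{i,n}$, $d_{i,n}d_{i,m}=\binom{n+m}{m}_{q_i}d_{i,n+m}$ (Gaussian binomial coefficients), and for every $r\in A_{i-1}$, $d_{i,n}(r)=0$ for all large $n$; moreover $\sigma_l d_{i,n}=\lambda_{l,i}^n d_{i,n}\sigma_l$ on $A_{i-1}$ for all $n\geq 0$ and $i<l\le N$. Fix such $\{d_{i,n}\}$ and let $F=\mathrm{Frac}(A)$, the division ring of fractions of $A$. Put $(X^{(N+1)}_1,\dots,X^{(N+1)}_N)=(X_1,\dots,X_N)$. For $j=N,N-1,\dots,2$, write $x_l=X^{(j+1)}_l$, and define $y_l=X^{(j)}_l$ by $y_l=x_l$ for $l\ge j$ and $$y_l=\sum_{n\ge0}q_j^{n(n+1)/2}(q_j-1)^{-n}\,\big(d_{j,n}\circ\sigma_j^{-n}\big)(x_l)\,x_j^{-n}\qquad(l<j),$$ where $d_{j,n}\circ\sigma_j^{-n}$ is transported along the algebra homomorphism $\theta_j:A_{j-1}\to F$,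 $X_l\mapsto x_l$ $(l<j)$. Let $A^{(j)}=\mathbb{K}\langle X^{(j)}_1,\dots,X^{(j)}_N\rangle\subseteq F$ for $2\le j\le N+1$, so $A^{(N+1)}=A$, and put $A'=A^{(2)}$. For a ring $R$, let $\mathrm{C.Spec}(R)$ be the set of completely prime ideals of $R$ (proper two-sided ideals $P$ such that $ab\in P$ implies $a\in P$ or $b\in P$), ordered by inclusion and with the Zariski topology, whose closed sets are the sets $\{P\mid S\subseteq P\}$, $S\subseteq R$. For $2\le j\le N$ and $\epsilon\in\{0,1\}$ let $\mathcal P_j^{0}(A^{(j+1)})$ (resp. $\mathcal P_j^{1}(A^{(j+1)})$) be the set of $P\in\mathrm{C.Spec}(A^{(j+1)})$ with $x_j\notin P$ (resp. $x_j\in P$), and define $\mathcal P_j^{\epsilon}(A^{(j)})\subseteq \mathrm{C.Spec}(A^{(j)})$ in the same way with $y_j$ in place of $x_j$; these carry the subspace topology. Then, for every $j$ with $2\le j\le N$: (a) the construction is well defined: $x_j\ne0$; $\theta_j$ exists and is unique; there is a unique algebra homomorphism $g_j:A^{(j)}\to A^{(j+1)}/\langle x_j\rangle$ with $y_i\mapsto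 x_i+\langle x_j\rangle$ for $1\le i\le N$, and it is surjective; and there is a unique map $\psi_j:\mathrm{C.Spec}(A^{(j+1)})\to\mathrm{C.Spec}(A^{(j)})$ with $$\psi_j(P)=\begin{cases}PS_j^{-1}\cap A^{(j)}&\text{if }x_j\notin P,\\ g_j^{-1}(P/\langle x_j\rangle)&\text{if }x_j\in P,\end{cases}$$ where $S_j=\{x_j^n\mid n\ge0\}$ and $PS_j^{-1}=\{p\,x_j^{-n}\mid p\in P,\ n\ge 0\}\subseteq F$; (b) $\psi_j$ is injective; (c) for each $\epsilon\in\{0,1\}$, $\psi_j(\mathcal P_j^\epsilon(A^{(j+1)}))$ is a closed subset of $\mathcal P_j^\epsilon(A^{(j)})$, and $\psi_j$ restricts to a homeomorphism $\mathcal P_j^\epsilon(A^{(j+1)})\to\psi_j(\mathcal P_j^\epsilon(A^{(j+1)}))$ that is bi-increasing, i.e. it and its inverse preserve inclusions. Consequently the canonical embedding $\psi=\psi_2\circ\cdots\circ\psi_N:\mathrm{C.Spec}(A)\to\mathrm{C.Spec}(A')$ (the identity if $N=1$) is injective. -/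

import Mathlib

/-! ## Ore extensions and higher skew derivations

All algebras below are subalgebras of a division ring `F`, which plays the role of the division
ring of fractions of the quantum nilpotent algebra. -/

/-- `δ` is a (left) `σ`-derivation of the `K`-algebra `R`. -/
def IsSkewDerivation {K R : Type*} [Field K] [Ring R] [Algebra K R]
    (σ : R ≃ₐ[K] R) (δ : R →ₗ[K] R) : Prop :=
  ∀ a b : R, δ (a * b) = σ a * δ b + δ a * b

/-- `S = R[x; σ, δ]`, for subalgebras `R`, `S` of `F`: `σ` is an automorphism of `R`, `δ` is a
`σ`-derivation of `R`, `S` is a ring containing `R` and `x` that is free as a left `R`-module with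
basis `1, x, x², …`, and `x r = σ(r) x + δ(r)` for all `r` in `R`. -/
structure IsOreExtension {K F : Type*} [Field K] [Ring F] [Algebra K F]
    (R S : Subalgebra K F) (x : F) (σ : R ≃ₐ[K] R) (δ : R →ₗ[K] R) : Prop where
  skew : IsSkewDerivation σ δ
  base_le : R ≤ S
  var_mem : x ∈ S
  free : ∀ s ∈ S, ∃! p : ℕ →₀ R, p.sum (fun k a => (a : F) * x ^ k) = s
  comm : ∀ r : R, x * (r : F) = (σ r : F) * x + (δ r : F)

/-- The Gaussian binomial coefficient (a polynomial in `q` with integer coefficients), evaluated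
at `q ∈ K`, through the `q`-Pascal rule. -/
def gaussBinom {K : Type*} [Field K] (q : K) : ℕ → ℕ → K
  | _, 0 => 1
  | 0, _ + 1 => 0
  | n + 1, k + 1 => gaussBinom q n k + q ^ (k + 1) * gaussBinom q n (k + 1)

/-- `d` is a higher `q`-skew `σ`-derivation on `R` extending `δ`. -/
structure IsHigherSkewDerivation {K R : Type*} [Field K] [Ring R] [Algebra K R]
    (q : K) (σ : R ≃ₐ[K] R) (δ : R →ₗ[K] R) (d : ℕ → R →ₗ[K] R) : Prop where
  zero : d 0 = LinearMap.id
  one : d 1 = δ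
  mul : ∀ (n : ℕ) (r s : R),
    d n (r * s) = ∑ i ∈ Finset.range (n + 1), (σ ^ (n - i)) (d i r) * d (n - i) s
  skew : ∀ (n : ℕ) (r : R), d n (σ r) = q ^ n • σ (d n r)

/-- Every element is killed by all but finitely many of the `d n`. -/
def IsLocallyNilpotent {K R : Type*} [Field K] [Ring R] [Algebra K R]
    (d : ℕ → R →ₗ[K] R) : Prop :=
  ∀ r : R, ∃ m : ℕ, ∀ n, m ≤ n → d n r = 0

/-- `d_n d_m = binom(n+m, m)_q d_{n+m}`. -/
def IsIterative {K R : Type*} [Field K] [Ring R] [Algebra K R]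
    (q : K) (d : ℕ → R →ₗ[K] R) : Prop :=
  ∀ (n m : ℕ) (r : R), d n (d m r) = gaussBinom q (n + m) m • d (n + m) r

/-! ## Quantum nilpotent algebras -/

/-- `lowerAlg K X i` is the subalgebra `A_{i-1}` generated by `X_1, …, X_{i-1}`. -/
def lowerAlg (K : Type*) {F : Type*} [Field K] [Ring F] [Algebra K F]
    (X : ℕ → F) (i : ℕ) : Subalgebra K F :=
  Algebra.adjoin K (X '' Set.Ico 1 i)

theorem mem_lowerAlg (K : Type*) {F : Type*} [Field K] [Ring F] [Algebra K F]
    (X : ℕ → F) {i l : ℕ} (hl : l ∈ Set.Ico 1 i) : X l ∈ lowerAlg K X i :=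
  Algebra.subset_adjoin (Set.mem_image_of_mem X hl)

theorem lowerAlg_mono (K : Type*) {F : Type*} [Field K] [Ring F] [Algebra K F]
    (X : ℕ → F) {i l : ℕ} (h : i ≤ l) : lowerAlg K X i ≤ lowerAlg K X l :=
  Algebra.adjoin_mono (Set.image_mono (Set.Ico_subset_Ico_right h))

/-- A quantum nilpotent algebra `A = K[X_1][X_2; σ_2, δ_2] ⋯ [X_N; σ_N, δ_N]`, given inside its
division ring of fractions `F = Frac(A)`, together with the higher skew derivations `d_{i,n}`
extending the `δ_i`. Generators are indexed by `1, …, N`; the values of the data at other indices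
(and of `σ_i`, `δ_i`, `d_{i,n}`, `q_i` at `i = 1`) play no role. The maps `σ_i`, `δ_i`, `d_{i,n}`
live on `A_{i-1} = lowerAlg K X i`. -/
structure QuantumNilpotent (K F : Type*) [Field K] [DivisionRing F] [Algebra K F] (N : ℕ) where
  X : ℕ → F
  σ : ∀ i : ℕ, lowerAlg K X i ≃ₐ[K] lowerAlg K X i
  δ : ∀ i : ℕ, lowerAlg K X i →ₗ[K] lowerAlg K X i
  d : ∀ i : ℕ, ℕ → lowerAlg K X i →ₗ[K] lowerAlg K X i
  q : ℕ → K
  lam : ℕ → ℕ → K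
  /-- `A_1 = K[X_1]` is a polynomial ring. -/
  ore_one : 1 ≤ N → IsOreExtension (lowerAlg K X 1) (lowerAlg K X 2) (X 1) AlgEquiv.refl 0
  /-- `A_i = A_{i-1}[X_i; σ_i, δ_i]`. -/
  ore : ∀ i, 2 ≤ i → i ≤ N →
    IsOreExtension (lowerAlg K X i) (lowerAlg K X (i + 1)) (X i) (σ i) (δ i)
  /-- `F` is the division ring of fractions of `A`. -/
  frac : ∀ f : F, ∃ a ∈ lowerAlg K X (N + 1), ∃ b ∈ lowerAlg K X (N + 1), b ≠ 0 ∧ f = a * b⁻¹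
  σ_gen : ∀ i, 2 ≤ i → i ≤ N → ∀ (l : ℕ) (hl : l ∈ Set.Ico 1 i),
    (σ i ⟨X l, mem_lowerAlg K X hl⟩ : F) = lam i l • X l
  lam_antisymm : ∀ i ∈ Set.Icc 1 N, ∀ l ∈ Set.Icc 1 N, lam i l * lam l i = 1
  q_ne_zero : ∀ i, 2 ≤ i → i ≤ N → q i ≠ 0
  q_ne_one : ∀ i, 2 ≤ i → i ≤ N → q i ≠ 1
  q_skew : ∀ i, 2 ≤ i → i ≤ N → ∀ a, δ i (σ i a) = q i • σ i (δ i a)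
  higher : ∀ i, 2 ≤ i → i ≤ N → IsHigherSkewDerivation (q i) (σ i) (δ i) (d i)
  nilpotent : ∀ i, 2 ≤ i → i ≤ N → IsLocallyNilpotent (d i)
  iterative : ∀ i, 2 ≤ i → i ≤ N → IsIterative (q i) (d i)
  /-- `σ_l ∘ d_{i,n} = λ_{l,i}^n d_{i,n} ∘ σ_l` on `A_{i-1}` for `l > i`; here `b` is `σ_l(a)`,
  which lies in `A_{i-1}` because `σ_l` scales the generators. -/
  σ_d : ∀ i, 2 ≤ i → ∀ l, (h : i + 1 ≤ l) → l ≤ N → ∀ (n : ℕ) (a b : lowerAlg K X i),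
    (b : F) = σ l (Subalgebra.inclusion (lowerAlg_mono K X (Nat.le_of_succ_le h)) a) →
    (σ l (Subalgebra.inclusion (lowerAlg_mono K X (Nat.le_of_succ_le h)) (d i n a)) : F) =
      lam l i ^ n • (d i n b : F)

namespace QuantumNilpotent

variable {K F : Type*} [Field K] [DivisionRing F] [Algebra K F] {N : ℕ}

/-! ## The deleting derivations algorithm -/

/-- `θ : A_{i-1} → F` is the homomorphism of algebras that sends `X_l` to `x_l` for `l < i`. -/
def IsTransport (D : QuantumNilpotent K F N) (i : ℕ) (x : ℕ → F)
    (θ : lowerAlg K D.X i →ₐ[K] F) : Prop :=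
  ∀ (l : ℕ) (hl : l ∈ Set.Ico 1 i), θ ⟨D.X l, mem_lowerAlg K D.X hl⟩ = x l

open Classical in
/-- The homomorphism `A_{i-1} → F`, `X_l ↦ x_l` (there is at most one; the value is `0` if there
is none), along which `d_{i,n} ∘ σ_i^{-n}` is read as a map on the copy of `A_{i-1}` generated
by `x_1, …, x_{i-1}`. -/
noncomputable def transport (D : QuantumNilpotent K F N) (i : ℕ) (x : ℕ → F)
    (a : lowerAlg K D.X i) : F :=
  if h : ∃ θ : lowerAlg K D.X i →ₐ[K] F, D.IsTransport i x θ then h.choose a else 0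

/-- The change of variables deleting the `j`-th derivation: `y_l = x_l` for `l ≥ j` and
`y_l = ∑ₙ q_j^{n(n+1)/2} (q_j - 1)^{-n} d_{j,n} ∘ σ_j^{-n}(x_l) x_j^{-n}` for `l < j`. -/
noncomputable def deleteStep (D : QuantumNilpotent K F N) (j : ℕ) (x : ℕ → F) (l : ℕ) : F :=
  if hl : l ∈ Set.Ico 1 j then
    ∑ᶠ n : ℕ, (D.q j ^ (n * (n + 1) / 2) * ((D.q j - 1) ^ n)⁻¹) •
      (D.transport j x (D.d j n ((D.σ j ^ n).symm ⟨D.X l, mem_lowerAlg K D.X hl⟩)) *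
        (x j ^ n)⁻¹)
  else x l

/-- The sequence `(X_1^{(j)}, …, X_N^{(j)})`: it is `(X_1, …, X_N)` for `j = N + 1`, and
`X^{(j)}` is obtained from `X^{(j+1)}` by deleting the `j`-th derivation for `2 ≤ j ≤ N`. -/
noncomputable def gens (D : QuantumNilpotent K F N) (j : ℕ) : ℕ → F :=
  if N < j then D.X else D.deleteStep j (D.gens (j + 1))
termination_by N + 1 - j

/-- `A^{(j)}`, the subalgebra of `F` generated by `X_1^{(j)}, …, X_N^{(j)}`. -/
noncomputable def alg (D : QuantumNilpotent K F N) (j : ℕ) : Subalgebra K F :=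
  Algebra.adjoin K (D.gens j '' Set.Icc 1 N)

theorem gens_mem (D : QuantumNilpotent K F N) (j : ℕ) {l : ℕ} (hl : l ∈ Set.Icc 1 N) :
    D.gens j l ∈ D.alg j :=
  Algebra.subset_adjoin (Set.mem_image_of_mem _ hl)

/-- `X_l^{(j)}` as an element of `A^{(j)}`. -/
noncomputable def gen (D : QuantumNilpotent K F N) (j l : ℕ) (hl : l ∈ Set.Icc 1 N) : D.alg j :=
  ⟨D.gens j l, D.gens_mem j hl⟩

/-- `A^{(N+1)} = A`. -/
theorem alg_last (D : QuantumNilpotent K F N) : D.alg (N + 1) = lowerAlg K D.X (N + 1) := by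
  have h : Set.Icc 1 N = Set.Ico 1 (N + 1) := by
    ext l
    simp only [Set.mem_Icc, Set.mem_Ico]
    omega
  rw [alg, gens, if_pos (Nat.lt_succ_self N), h, lowerAlg]

end QuantumNilpotent

/-! ## The completely prime spectrum -/

/-- `C.Spec(R)`: the completely prime ideals of `R`, that is, the proper two-sided ideals `P` such
that `ab ∈ P` implies `a ∈ P` or `b ∈ P`; ordered by inclusion. -/
abbrev CSpec (R : Type*) [Ring R] : Type _ :=
  {P : TwoSidedIdeal R // (1 : R) ∉ P ∧ ∀ a b : R, a * b ∈ P → a ∈ P ∨ b ∈ P}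

/-- The set of completely prime ideals containing `S`. -/
def cspecZeroLocus {R : Type*} [Ring R] (S : Set R) : Set (CSpec R) :=
  {P | ∀ s ∈ S, s ∈ P.1}

/-- The Zariski topology on `C.Spec(R)`: the closed sets are the sets `V(S)`. -/
instance cspecZariski (R : Type*) [Ring R] : TopologicalSpace (CSpec R) :=
  TopologicalSpace.ofClosed (Set.range (cspecZeroLocus (R := R)))
    ⟨Set.univ, by
      ext P
      simp only [cspecZeroLocus, Set.mem_ofPred_eq, Set.mem_empty_iff_false, iff_false]
      exact fun h => P.2.1 (h 1 (Set.mem_univ _))⟩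
    (by
      intro 𝒜 h𝒜
      refine ⟨⋃₀ {S | cspecZeroLocus S ∈ 𝒜}, ?_⟩
      ext P
      simp only [cspecZeroLocus, Set.mem_ofPred_eq, Set.mem_sUnion, Set.mem_sInter]
      constructor
      · intro h t ht
        obtain ⟨S, rfl⟩ := h𝒜 ht
        exact fun s hs => h s ⟨S, ht, hs⟩
      · rintro h s ⟨S, hS, hs⟩
        exact h _ hS s hs)
    (by
      rintro _ ⟨S, rfl⟩ _ ⟨T, rfl⟩
      refine ⟨{r | ∃ s ∈ S, ∃ t ∈ T, r = s * t}, ?_⟩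
      ext P
      simp only [cspecZeroLocus, Set.mem_ofPred_eq, Set.mem_union]
      constructor
      · intro h
        by_contra! hc
        obtain ⟨⟨s, hs, hsP⟩, t, ht, htP⟩ := hc
        rcases P.2.2 s t (h _ ⟨s, hs, t, ht, rfl⟩) with h1 | h1
        · exact hsP h1
        · exact htP h1
      · rintro (h | h) _ ⟨s, hs, t, ht, rfl⟩
        · exact P.1.mul_mem_right _ _ (h s hs)
        · exact P.1.mul_mem_left _ _ (h t ht))

/-- `P^0 = {P | x ∉ P}` and `P^1 = {P | x ∈ P}`. -/
def cspecPiece {R : Type*} [Ring R] (x : R) (ε : Fin 2) : Set (CSpec R) :=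
  {P | x ∈ P.1 ↔ ε = 1}

namespace QuantumNilpotent

variable {K F : Type*} [Field K] [DivisionRing F] [Algebra K F] {N : ℕ}

/-! ## The canonical embedding -/

/-- The two-sided ideal `⟨x_j⟩` of `A^{(j+1)}`, where `x_j = X_j^{(j+1)}`. -/
noncomputable def varIdeal (D : QuantumNilpotent K F N) (j : ℕ) (hj : j ∈ Set.Icc 1 N) :
    TwoSidedIdeal (D.alg (j + 1)) :=
  TwoSidedIdeal.span {D.gen (j + 1) j hj}

/-- The algebra `A^{(j+1)}/⟨x_j⟩`. -/
abbrev Quot (D : QuantumNilpotent K F N) (j : ℕ) (hj : j ∈ Set.Icc 1 N) : Type _ :=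
  (D.varIdeal j hj).ringCon.Quotient

/-- `g : A^{(j)} → A^{(j+1)}/⟨x_j⟩` is the homomorphism of algebras that sends
`y_i = X_i^{(j)}` to the class of `x_i = X_i^{(j+1)}`, for `1 ≤ i ≤ N`. -/
def IsPullbackHom (D : QuantumNilpotent K F N) (j : ℕ) (hj : j ∈ Set.Icc 1 N)
    (g : D.alg j →ₐ[K] D.Quot j hj) : Prop :=
  ∀ (i : ℕ) (hi : i ∈ Set.Icc 1 N),
    g (D.gen j i hi) = (D.varIdeal j hj).ringCon.mk' (D.gen (j + 1) i hi)

/-- `ψ` is the map `ψ_j : C.Spec(A^{(j+1)}) → C.Spec(A^{(j)})`: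
`ψ_j(P) = P S_j^{-1} ∩ A^{(j)}` if `x_j ∉ P`, where `S_j = {x_j^n}` and `P S_j^{-1} ⊆ F`, and
`ψ_j(P) = g_j^{-1}(P/⟨x_j⟩)` if `x_j ∈ P`. -/
structure IsStepMap (D : QuantumNilpotent K F N) (j : ℕ) (hj : j ∈ Set.Icc 1 N)
    (ψ : CSpec (D.alg (j + 1)) → CSpec (D.alg j)) : Prop where
  of_notMem : ∀ P : CSpec (D.alg (j + 1)), D.gen (j + 1) j hj ∉ P.1 →
    ∀ a : D.alg j, a ∈ (ψ P).1 ↔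
      ∃ p ∈ P.1, ∃ n : ℕ, (a : F) = (p : F) * (D.gens (j + 1) j ^ n)⁻¹
  of_mem : ∀ P : CSpec (D.alg (j + 1)), D.gen (j + 1) j hj ∈ P.1 →
    ∃ g : D.alg j →ₐ[K] D.Quot j hj, D.IsPullbackHom j hj g ∧
      ∀ a : D.alg j, a ∈ (ψ P).1 ↔ ∃ p ∈ P.1, g a = (D.varIdeal j hj).ringCon.mk' p

/-- `ψ_2 ∘ ⋯ ∘ ψ_{m+1} : C.Spec(A^{(m+2)}) → C.Spec(A^{(2)})`. -/
def composite (D : QuantumNilpotent K F N)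
    (ψ : ∀ j : ℕ, CSpec (D.alg (j + 1)) → CSpec (D.alg j)) :
    ∀ m : ℕ, CSpec (D.alg (m + 2)) → CSpec (D.alg 2)
  | 0 => id
  | m + 1 => composite D ψ m ∘ ψ (m + 2)

end QuantumNilpotent

/-! Fix `j`, write `x` for `x_j`, `θ` for the copy of `A_{j-1}` inside `F`, and `f(a)` for the sum
`∑ c_n θ(d_n σ^{-n} a) x^{-n}`, which is finite by local nilpotence. Everything rests on two facts
about `f`: it satisfies `x f(a) = f(σ a) x` (`mul_deletionMap`), so the derivation has disappeared,
and it is multiplicative (`deletionMap_mul`). Both come down to identities for `c_n = q^{n(n+1)/2}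
(q-1)^{-n}`, combined with iterativity for the first and with the higher Leibniz rule for the
second.

Descending induction on `j` (`IsLevel`, `IsLevel.pred`) then describes `A^{(j)}`: it contains a
faithful copy of `A_{j-1}`, and each remaining variable commutes up to scalars with all earlier ones
and has independent powers over the algebra they generate. That the later variables keep their
scalars is the content of the compatibility `σ_d` between `σ_l` and `d_{i,n}`.

For the spectra, the two strata are handled by two rings, each receiving maps from both algebras.
When `x ∉ P`, it is a common localization: inverting `x` in `A^{(j)}` or in `A^{(j+1)}` yields the
same subalgebra of `F` (`isPowLocalization`, `isPowLocalization_succ`). When `x ∈ P`, it is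
`A^{(j+1)}/⟨x⟩`, on which `A^{(j)}` maps onto by `g_j`; this map exists because the subalgebra of `F
× A^{(j+1)}/⟨x⟩` generated by the pairs `(y_i, x_i + ⟨x⟩)` is a graph (`eq_zero_of_graphGen`).

All four maps hit every element of their target up to a unit, so contraction along each is an
embedding for order and topology (`isEmbedding_cspecComap`). On either stratum `ψ_j` transports one
such embedding to the other. Its image is the whole stratum in the first case and the zero locus of
`ker g_j` in the second. Since the strata are preserved, `ψ_j` is injective. -/

/-! ## Generalities on subalgebras -/

section Adjoin

variable {K T : Type*} [Field K] [Ring T] [Algebra K T]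

/-- The invariant of the induction is stability of `M` under left multiplication by `u`, so `M` need
only be a subspace. It is later a set of fractions not known to be closed under products. -/
theorem adjoin_le_of_mul_mem_left {S : Set T} {M : Submodule K T} (h1 : (1 : T) ∈ M)
    (h : ∀ s ∈ S, ∀ m ∈ M, s * m ∈ M) {u : T} (hu : u ∈ Algebra.adjoin K S) : u ∈ M := by
  have key : ∀ m ∈ M, u * m ∈ M := by
    induction hu using Algebra.adjoin_induction with
    | mem s hs => exact h s hs
    | algebraMap r => intro m hm; rw [← Algebra.smul_def]; exact M.smul_mem r hm
    | add a b _ _ ha hb => intro m hm; rw [add_mul]; exact M.add_mem (ha m hm) (hb m hm)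
    | mul a b _ _ ha hb => intro m hm; rw [mul_assoc]; exact ha _ (hb m hm)
  simpa using key 1 h1

theorem adjoin_le_of_mul_mem_right {S : Set T} {M : Submodule K T} (h1 : (1 : T) ∈ M)
    (h : ∀ s ∈ S, ∀ m ∈ M, m * s ∈ M) {u : T} (hu : u ∈ Algebra.adjoin K S) : u ∈ M := by
  have key : ∀ m ∈ M, m * u ∈ M := by
    induction hu using Algebra.adjoin_induction with
    | mem s hs => exact h s hs
    | algebraMap r =>
      intro m hm
      rw [← Algebra.commutes, ← Algebra.smul_def]
      exact M.smul_mem r hm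
    | add a b _ _ ha hb => intro m hm; rw [mul_add]; exact M.add_mem (ha m hm) (hb m hm)
    | mul a b _ _ ha hb => intro m hm; rw [← mul_assoc]; exact hb _ (ha m hm)
  simpa using key 1 h1

/-- An element that commutes up to scalars with generators of an algebra normalises it. -/
theorem exists_mul_eq_mul_of_adjoin {S : Set T} {w : T}
    (h : ∀ s ∈ S, ∃ c : K, w * s = c • (s * w)) {u : T} (hu : u ∈ Algebra.adjoin K S) :
    ∃ v ∈ Algebra.adjoin K S, w * u = v * w := by
  induction hu using Algebra.adjoin_induction with
  | mem s hs =>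
    obtain ⟨c, hc⟩ := h s hs
    exact ⟨c • s, Subalgebra.smul_mem _ (Algebra.subset_adjoin hs) c, by rw [hc, smul_mul_assoc]⟩
  | algebraMap r => exact ⟨_, Subalgebra.algebraMap_mem _ r, (Algebra.commutes r w).symm⟩
  | add a b _ _ ha hb =>
    obtain ⟨a', ha', ea⟩ := ha
    obtain ⟨b', hb', eb⟩ := hb
    exact ⟨a' + b', add_mem ha' hb', by rw [mul_add, add_mul, ea, eb]⟩
  | mul a b _ _ ha hb =>
    obtain ⟨a', ha', ea⟩ := ha
    obtain ⟨b', hb', eb⟩ := hb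
    exact ⟨a' * b', mul_mem ha' hb', by rw [← mul_assoc, ea, mul_assoc, eb, mul_assoc]⟩

theorem exists_mul_eq_mul_of_adjoin' {S : Set T} {w : T}
    (h : ∀ s ∈ S, ∃ c : K, s * w = c • (w * s)) {u : T} (hu : u ∈ Algebra.adjoin K S) :
    ∃ v ∈ Algebra.adjoin K S, u * w = w * v := by
  induction hu using Algebra.adjoin_induction with
  | mem s hs =>
    obtain ⟨c, hc⟩ := h s hs
    exact ⟨c • s, Subalgebra.smul_mem _ (Algebra.subset_adjoin hs) c, by rw [hc, mul_smul_comm]⟩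
  | algebraMap r => exact ⟨_, Subalgebra.algebraMap_mem _ r, Algebra.commutes r w⟩
  | add a b _ _ ha hb =>
    obtain ⟨a', ha', ea⟩ := ha
    obtain ⟨b', hb', eb⟩ := hb
    exact ⟨a' + b', add_mem ha' hb', by rw [mul_add, add_mul, ea, eb]⟩
  | mul a b _ _ ha hb =>
    obtain ⟨a', ha', ea⟩ := ha
    obtain ⟨b', hb', eb⟩ := hb
    exact ⟨a' * b', mul_mem ha' hb', by rw [mul_assoc, eb, ← mul_assoc, ea, mul_assoc]⟩

/-- If `w` normalises `C`, every element of the algebra generated by `C` and `w` is a left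
polynomial in `w` with coefficients in `C`. -/
theorem exists_eval_eq_of_adjoin {S : Set T} {C : Subalgebra K T} {w : T}
    (hS : S ⊆ insert w C) (hw : ∀ c ∈ C, ∃ c' ∈ C, w * c = c' * w)
    {u : T} (hu : u ∈ Algebra.adjoin K S) :
    ∃ p : Polynomial T, (∀ k, p.coeff k ∈ C) ∧ p.eval w = u := by
  let M : Submodule K T :=
    { carrier := {u | ∃ p : Polynomial T, (∀ k, p.coeff k ∈ C) ∧ p.eval w = u}
      zero_mem' := ⟨0, fun k => by simp, by simp⟩
      add_mem' := by
        rintro _ _ ⟨p, hp, rfl⟩ ⟨q, hq, rfl⟩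
        exact ⟨p + q, fun k => by simpa using add_mem (hp k) (hq k), by simp⟩
      smul_mem' := by
        rintro c _ ⟨p, hp, rfl⟩
        refine ⟨Polynomial.C (algebraMap K T c) * p, fun k => ?_, ?_⟩
        · rw [Polynomial.coeff_C_mul]
          exact mul_mem (Subalgebra.algebraMap_mem _ c) (hp k)
        · rw [Polynomial.eval_C_mul, Algebra.smul_def] }
  refine adjoin_le_of_mul_mem_left (M := M) ⟨1, fun k => ?_, by simp⟩ ?_ hu
  · rw [Polynomial.coeff_one]
    split_ifs
    exacts [one_mem _, zero_mem _]
  · rintro s hs _ ⟨p, hp, rfl⟩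
    rcases hS hs with rfl | hsC
    · rw [Polynomial.eval_eq_sum, Polynomial.sum, Finset.mul_sum]
      refine Submodule.sum_mem _ fun k _ => ?_
      obtain ⟨c', hc', e⟩ := hw _ (hp k)
      refine ⟨Polynomial.monomial (k + 1) c', fun i => ?_, ?_⟩
      · rw [Polynomial.coeff_monomial]
        split_ifs
        exacts [hc', zero_mem _]
      · rw [Polynomial.eval_monomial, ← mul_assoc, e, pow_succ', mul_assoc]
    · refine ⟨Polynomial.C s * p, fun k => ?_, Polynomial.eval_C_mul⟩
      rw [Polynomial.coeff_C_mul]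
      exact mul_mem hsC (hp k)

end Adjoin

/-- The powers of `x` are left linearly independent over `C`. -/
def IsLeftFree {K T : Type*} [Field K] [Ring T] [Algebra K T] (C : Subalgebra K T) (x : T) :
    Prop :=
  ∀ p : Polynomial T, (∀ k, p.coeff k ∈ C) → p.eval x = 0 → p = 0

/-! ## The coefficients -/

section Coefficients

variable {K : Type*} [Field K]

theorem gaussBinom_eq_zero (q : K) {n k : ℕ} (h : n < k) : gaussBinom q n k = 0 := by
  induction n generalizing k with
  | zero => cases k with
    | zero => omega
    | succ k => rfl
  | succ n ih => cases k with
    | zero => omega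
    | succ k => rw [gaussBinom, ih (by omega), ih (by omega), mul_zero, add_zero]

theorem gaussBinom_self (q : K) (n : ℕ) : gaussBinom q n n = 1 := by
  induction n with
  | zero => rfl
  | succ n ih => rw [gaussBinom, ih, gaussBinom_eq_zero q (by omega), mul_zero, add_zero]

/-- This binomial is the `q`-integer `1 + q + ⋯ + q^n`; the factor `q - 1` keeps the statement free
of division. -/
theorem gaussBinom_succ_self (q : K) (n : ℕ) :
    gaussBinom q (n + 1) n * (q - 1) = q ^ (n + 1) - 1 := by
  induction n with
  | zero => simp [gaussBinom]
  | succ n ih =>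
    rw [gaussBinom, add_mul, ih, gaussBinom_self]
    ring

/-- The coefficients `q^{n(n+1)/2} (q-1)^{-n}`. -/
def deletionCoeff (q : K) (n : ℕ) : K := q ^ (n * (n + 1) / 2) * ((q - 1) ^ n)⁻¹

theorem deletionCoeff_zero (q : K) : deletionCoeff q 0 = 1 := by simp [deletionCoeff]

/-- Triangular numbers satisfy `T(n+m) = T(n) + T(m) + nm`. The extra `q^{nm}` will cancel the
scalar produced when `d_n` is moved past `σ^m`. -/
theorem deletionCoeff_add (q : K) (n m : ℕ) :
    deletionCoeff q (n + m) = q ^ (n * m) * (deletionCoeff q n * deletionCoeff q m) := by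
  have h : (n + m) * (n + m + 1) / 2 = n * m + n * (n + 1) / 2 + m * (m + 1) / 2 := by
    obtain ⟨a, ha⟩ := (Nat.even_mul_succ_self n).two_dvd
    obtain ⟨b, hb⟩ := (Nat.even_mul_succ_self m).two_dvd
    have : (n + m) * (n + m + 1) = 2 * (n * m + a + b) := by
      linear_combination ha + hb
    rw [this, ha, hb]
    simp
  rw [deletionCoeff, h, deletionCoeff, deletionCoeff, pow_add, pow_add, pow_add, mul_inv]
  ring

/-- This is the comparison of coefficients required by `x f(a) = f(σ a) x`: the first summand comes
from the `σ`-part of the commutation rule, the second from the `δ`-part one degree lower. -/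
theorem deletionCoeff_succ {q : K} (hq : q ≠ 0) (hq1 : q ≠ 1) (n : ℕ) :
    deletionCoeff q (n + 1) * (q ^ (n + 1))⁻¹ + deletionCoeff q n * gaussBinom q (n + 1) n =
      deletionCoeff q (n + 1) := by
  have h1 : q - 1 ≠ 0 := sub_ne_zero.2 hq1
  have h2 : gaussBinom q (n + 1) n = (q ^ (n + 1) - 1) / (q - 1) := by
    rw [eq_div_iff h1, gaussBinom_succ_self]
  have h3 : deletionCoeff q 1 = q / (q - 1) := by
    simp [deletionCoeff, div_eq_mul_inv]
  rw [deletionCoeff_add, h2, h3]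
  field_simp
  ring

end Coefficients

/-! ## The deletion homomorphism -/

/-- The data of one step of the deleting derivations algorithm: `x θ(r) = θ(σ r) x + θ(δ r)`, where
`δ` extends to a locally nilpotent, iterative higher `q`-skew `σ`-derivation. -/
structure IsDeletionDatum {K R F : Type*} [Field K] [Ring R] [Algebra K R] [DivisionRing F]
    [Algebra K F] (q : K) (σ : R ≃ₐ[K] R) (δ : R →ₗ[K] R) (d : ℕ → R →ₗ[K] R)
    (θ : R →ₐ[K] F) (x : F) : Prop where
  q_ne_zero : q ≠ 0
  q_ne_one : q ≠ 1
  higher : IsHigherSkewDerivation q σ δ d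
  nilpotent : IsLocallyNilpotent d
  iterative : IsIterative q d
  x_ne_zero : x ≠ 0
  comm : ∀ a, x * θ a = θ (σ a) * x + θ (δ a)

section HigherSkew

variable {K R : Type*} [Field K] [Ring R] [Algebra K R] {q : K} {σ : R ≃ₐ[K] R}
  {δ : R →ₗ[K] R} {d : ℕ → R →ₗ[K] R}

namespace IsHigherSkewDerivation

theorem d_pow (h : IsHigherSkewDerivation q σ δ d) (n m : ℕ) (a : R) :
    d n ((σ ^ m) a) = q ^ (n * m) • (σ ^ m) (d n a) := by
  induction m with
  | zero => simp
  | succ m ih =>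
    rw [pow_succ', AlgEquiv.mul_apply, AlgEquiv.mul_apply, h.skew, ih, map_smul, smul_smul,
      ← pow_add]
    congr 2
    ring

/-- The shape is dictated by the Leibniz rule: `σ^m d_n σ^{-(n+m)} a` is the left factor of the
terms of `d_{n+m} σ^{-(n+m)} (a b)`. -/
theorem pow_d_symm (h : IsHigherSkewDerivation q σ δ d) (hq : q ≠ 0) (n m k : ℕ) (a : R) :
    (σ ^ m) (d n ((σ ^ (k + m)).symm a)) = (q ^ (n * m))⁻¹ • d n ((σ ^ k).symm a) := by
  have e : (σ ^ k).symm a = (σ ^ m) ((σ ^ (k + m)).symm a) := by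
    rw [AlgEquiv.symm_apply_eq, ← AlgEquiv.mul_apply, ← pow_add, AlgEquiv.apply_symm_apply]
  rw [e, h.d_pow, smul_smul, inv_mul_cancel₀ (pow_ne_zero _ hq), one_smul]

theorem d_symm (h : IsHigherSkewDerivation q σ δ d) (hq : q ≠ 0) (n m : ℕ) (a : R) :
    d n ((σ ^ m).symm a) = (q ^ (n * m))⁻¹ • (σ ^ m).symm (d n a) := by
  have e := h.pow_d_symm hq n m 0 a
  have e' : ((σ ^ 0).symm a) = a := by
    rw [AlgEquiv.symm_apply_eq, pow_zero, AlgEquiv.one_apply]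
  rw [zero_add, e'] at e
  refine (σ ^ m).injective ?_
  rw [map_smul, AlgEquiv.apply_symm_apply, e]

/-- By induction only the two extreme terms survive in the expansion of `d_n(1 · 1)`, which reads
`d_n 1 = d_n 1 + d_n 1`. -/
theorem d_map_one (h : IsHigherSkewDerivation q σ δ d) {n : ℕ} (hn : n ≠ 0) : d n 1 = 0 := by
  induction n using Nat.strong_induction_on with
  | _ n ih =>
    have e := h.mul n 1 1
    rw [Finset.sum_range_succ, mul_one, Nat.sub_self, h.zero] at e
    obtain ⟨k, rfl⟩ := Nat.exists_eq_succ_of_ne_zero hn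
    rw [Nat.succ_eq_add_one, Finset.sum_range_succ', Finset.sum_eq_zero, h.zero] at e
    · simpa using e
    · intro i hi
      rw [ih (i + 1) (by simp at hi; omega) (by omega)]
      simp

end IsHigherSkewDerivation

end HigherSkew

section DeletionHom

variable {K R F : Type*} [Field K] [Ring R] [Algebra K R] [DivisionRing F] [Algebra K F]
  {q : K} {σ : R ≃ₐ[K] R} {δ : R →ₗ[K] R} {d : ℕ → R →ₗ[K] R} {θ : R →ₐ[K] F} {x : F}

/-- The map `a ↦ ∑ₙ q^{n(n+1)/2} (q-1)^{-n} θ(d_n σ^{-n} a) x^{-n}`. -/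
noncomputable def deletionMap (q : K) (σ : R ≃ₐ[K] R) (d : ℕ → R →ₗ[K] R) (θ : R →ₐ[K] F) (x : F)
    (a : R) : F :=
  ∑ᶠ n : ℕ, deletionCoeff q n • (θ (d n ((σ ^ n).symm a)) * (x ^ n)⁻¹)

namespace IsDeletionDatum

variable (h : IsDeletionDatum q σ δ d θ x)
include h

theorem d_symm_eq_zero {n : ℕ} (m : ℕ) {a : R} (ha : d n a = 0) : d n ((σ ^ m).symm a) = 0 := by
  rw [h.higher.d_symm h.q_ne_zero, ha, map_zero, smul_zero]

theorem deletionMap_eq_sum {M : ℕ} {a : R} (ha : ∀ n, M ≤ n → d n a = 0) :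
    deletionMap q σ d θ x a = ∑ n ∈ Finset.range M,
      deletionCoeff q n • (θ (d n ((σ ^ n).symm a)) * (x ^ n)⁻¹) := by
  refine finsum_eq_sum_of_support_subset _ fun n hn => ?_
  by_contra hc
  refine hn ?_
  have : M ≤ n := by simpa using hc
  beta_reduce
  rw [h.d_symm_eq_zero n (ha n this), map_zero, zero_mul, smul_zero]

theorem d_map_eq_zero {n : ℕ} {a : R} (ha : d n a = 0) : d n (σ a) = 0 := by
  rw [h.higher.skew, ha, map_zero, smul_zero]

/-- Pushing `x` through the `n`-th coefficient gives a `σ`-term in degree `n`, scaled by `q^{-n}`,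
and a `δ`-term which iterativity turns into a multiple of the term of degree `n + 1`. Regrouping by
degree leaves the recursion `deletionCoeff_succ`. -/
theorem mul_deletionMap (a : R) :
    x * deletionMap q σ d θ x a = deletionMap q σ d θ x (σ a) * x := by
  obtain ⟨M, hM⟩ := h.nilpotent a
  have hM1 : ∀ n, M + 1 ≤ n → d n a = 0 := fun n hn => hM n (by omega)
  have hb : ∀ n, M ≤ n → d n (σ a) = 0 := fun n hn => h.d_map_eq_zero (hM n hn)
  have hb1 : ∀ n, M + 1 ≤ n → d n (σ a) = 0 := fun n hn => hb n (by omega)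
  rw [h.deletionMap_eq_sum hM, h.deletionMap_eq_sum hb1, Finset.mul_sum, Finset.sum_mul]
  have hz : ∀ n : ℕ, (x ^ n)⁻¹ = x * (x ^ (n + 1))⁻¹ := fun n => by
    rw [pow_succ, mul_inv_rev, ← mul_assoc, mul_inv_cancel₀ h.x_ne_zero, one_mul]
  have hz' : ∀ n : ℕ, (x ^ n)⁻¹ * x = x * (x ^ n)⁻¹ := fun n =>
    ((Commute.refl x).pow_left n).inv_left₀.eq
  let f : ℕ → F := fun n => θ (d n ((σ ^ n).symm (σ a))) * (x * (x ^ n)⁻¹)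
  have es : ∀ n, (σ ^ n).symm a = (σ ^ (n + 1)).symm (σ a) := fun n => by
    rw [AlgEquiv.eq_symm_apply, pow_succ', AlgEquiv.mul_apply, AlgEquiv.apply_symm_apply]
  have e1 : ∀ n, x * (deletionCoeff q n • (θ (d n ((σ ^ n).symm a)) * (x ^ n)⁻¹)) =
      (deletionCoeff q n * (q ^ n)⁻¹) • f n +
        (deletionCoeff q n * gaussBinom q (n + 1) n) • f (n + 1) := by
    intro n
    have h1 : σ (d n ((σ ^ n).symm a)) = (q ^ n)⁻¹ • d n ((σ ^ n).symm (σ a)) := by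
      have := h.higher.pow_d_symm h.q_ne_zero n 1 n (σ a)
      rwa [pow_one, mul_one, ← es] at this
    have h2 : δ (d n ((σ ^ n).symm a)) =
        gaussBinom q (n + 1) n • d (n + 1) ((σ ^ (n + 1)).symm (σ a)) := by
      rw [← h.higher.one, h.iterative, ← es, add_comm 1 n]
    rw [mul_smul_comm, ← mul_assoc, h.comm, h1, h2, add_mul, smul_add, map_smul, map_smul,
      mul_smul, mul_smul]
    simp only [f, smul_mul_assoc, mul_assoc, ← hz]
  have e2 : ∀ n, deletionCoeff q n • (θ (d n ((σ ^ n).symm (σ a))) * (x ^ n)⁻¹) * x =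
      deletionCoeff q n • f n := by
    intro n
    rw [smul_mul_assoc, mul_assoc, hz']
  -- The top term vanishes, so the `σ`-sum may run up to `M` and can be shifted in step with the
  -- `δ`-sum.
  have fM : f M = 0 := by
    simp only [f]
    rw [h.d_symm_eq_zero M (hb M le_rfl), map_zero, zero_mul]
  rw [Finset.sum_congr rfl fun n _ => e1 n, Finset.sum_congr rfl fun n _ => e2 n,
    Finset.sum_add_distrib]
  have e3 : ∑ n ∈ Finset.range M, (deletionCoeff q n * (q ^ n)⁻¹) • f n =
      ∑ n ∈ Finset.range (M + 1), (deletionCoeff q n * (q ^ n)⁻¹) • f n := by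
    rw [Finset.sum_range_succ, fM, smul_zero, add_zero]
  rw [e3, Finset.sum_range_succ', Finset.sum_range_succ', add_right_comm,
    ← Finset.sum_add_distrib]
  congr 1
  · refine Finset.sum_congr rfl fun n _ => ?_
    rw [← add_smul, deletionCoeff_succ h.q_ne_zero h.q_ne_one]
  · simp

theorem pow_inv_mul_deletionMap (n : ℕ) (a : R) :
    (x ^ n)⁻¹ * deletionMap q σ d θ x a = deletionMap q σ d θ x ((σ ^ n).symm a) * (x ^ n)⁻¹ := by
  have key : ∀ (n : ℕ) (b : R), x ^ n * deletionMap q σ d θ x b =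
      deletionMap q σ d θ x ((σ ^ n) b) * x ^ n := by
    intro n
    induction n with
    | zero => intro b; simp
    | succ n ih =>
      intro b
      rw [pow_succ, mul_assoc, h.mul_deletionMap, ← mul_assoc, ih, mul_assoc, pow_succ σ,
        AlgEquiv.mul_apply]
  have hx := pow_ne_zero n h.x_ne_zero
  have := key n ((σ ^ n).symm a)
  rw [AlgEquiv.apply_symm_apply] at this
  rw [eq_mul_inv_iff_mul_eq₀ hx, mul_assoc, ← this, inv_mul_cancel_left₀ hx]

theorem deletionMap_add (a b : R) :
    deletionMap q σ d θ x (a + b) = deletionMap q σ d θ x a + deletionMap q σ d θ x b := by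
  obtain ⟨A, hA⟩ := h.nilpotent a
  obtain ⟨B, hB⟩ := h.nilpotent b
  have hA' : ∀ n, max A B ≤ n → d n a = 0 := fun n hn => hA n (le_of_max_le_left hn)
  have hB' : ∀ n, max A B ≤ n → d n b = 0 := fun n hn => hB n (le_of_max_le_right hn)
  rw [h.deletionMap_eq_sum hA', h.deletionMap_eq_sum hB', h.deletionMap_eq_sum (M := max A B),
    ← Finset.sum_add_distrib]
  · refine Finset.sum_congr rfl fun n _ => ?_
    rw [map_add, map_add, map_add, add_mul, smul_add]
  · intro n hn
    rw [map_add, hA' n hn, hB' n hn, add_zero]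

theorem deletionMap_smul (c : K) (a : R) :
    deletionMap q σ d θ x (c • a) = c • deletionMap q σ d θ x a := by
  obtain ⟨A, hA⟩ := h.nilpotent a
  rw [h.deletionMap_eq_sum hA, h.deletionMap_eq_sum (M := A), Finset.smul_sum]
  · refine Finset.sum_congr rfl fun n _ => ?_
    rw [map_smul, map_smul, map_smul, smul_mul_assoc, smul_comm]
  · intro n hn
    rw [map_smul, hA n hn, smul_zero]

theorem deletionMap_one : deletionMap q σ d θ x 1 = 1 := by
  rw [h.deletionMap_eq_sum (M := 1) fun n hn => h.higher.d_map_one (by omega)]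
  simp [deletionCoeff_zero, h.higher.zero]

/-- Moving `x^{-n}` across the second series makes the product a double sum over `(n, m)`. The
Leibniz rule writes the degree `N` term of `f(ab)` as the sum over `n + m = N` of the same terms,
the scalars agreeing by `deletionCoeff_add` and `pow_d_symm`. -/
theorem deletionMap_mul (a b : R) :
    deletionMap q σ d θ x (a * b) = deletionMap q σ d θ x a * deletionMap q σ d θ x b := by
  obtain ⟨A, hA⟩ := h.nilpotent a
  obtain ⟨B, hB⟩ := h.nilpotent b
  let f : ℕ × ℕ → F := fun p => deletionCoeff q p.1 • deletionCoeff q p.2 •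
    (θ (d p.1 ((σ ^ p.1).symm a) * d p.2 ((σ ^ (p.1 + p.2)).symm b)) * (x ^ (p.1 + p.2))⁻¹)
  have hf : ∀ p : ℕ × ℕ, A ≤ p.1 ∨ B ≤ p.2 → f p = 0 := by
    rintro p (hp | hp)
    · simp only [f]
      rw [h.d_symm_eq_zero _ (hA _ hp), zero_mul, map_zero, zero_mul, smul_zero, smul_zero]
    · simp only [f]
      rw [h.d_symm_eq_zero _ (hB _ hp), mul_zero, map_zero, zero_mul, smul_zero, smul_zero]
  have e1 : deletionMap q σ d θ x a * deletionMap q σ d θ x b =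
      ∑ p ∈ Finset.range A ×ˢ Finset.range B, f p := by
    rw [h.deletionMap_eq_sum hA, Finset.sum_mul, Finset.sum_product]
    refine Finset.sum_congr rfl fun n _ => ?_
    rw [smul_mul_assoc, mul_assoc, h.pow_inv_mul_deletionMap,
      h.deletionMap_eq_sum (M := B) fun k hk => h.d_symm_eq_zero n (hB k hk), Finset.sum_mul,
      Finset.mul_sum, Finset.smul_sum]
    refine Finset.sum_congr rfl fun m _ => ?_
    have e : (σ ^ m).symm ((σ ^ n).symm b) = (σ ^ (n + m)).symm b := by
      rw [AlgEquiv.eq_symm_apply, pow_add, AlgEquiv.mul_apply, AlgEquiv.apply_symm_apply,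
        AlgEquiv.apply_symm_apply]
    simp only [f, e, smul_mul_assoc, mul_smul_comm, map_mul, mul_assoc]
    rw [← mul_inv_rev, ← pow_add]
  have hterm : ∀ N : ℕ, deletionCoeff q N • (θ (d N ((σ ^ N).symm (a * b))) * (x ^ N)⁻¹) =
      ∑ p ∈ Finset.HasAntidiagonal.antidiagonal N, f p := by
    intro N
    rw [map_mul, h.higher.mul, Finset.Nat.sum_antidiagonal_eq_sum_range_succ_mk, map_sum,
      Finset.sum_mul, Finset.smul_sum]
    refine Finset.sum_congr rfl fun n hn => ?_
    obtain ⟨m, rfl⟩ := Nat.exists_eq_add_of_le (Nat.lt_succ_iff.1 (Finset.mem_range.1 hn))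
    have hc : deletionCoeff q (n + m) * (q ^ (n * m))⁻¹ =
        deletionCoeff q n * deletionCoeff q m := by
      rw [deletionCoeff_add, mul_comm, inv_mul_cancel_left₀ (pow_ne_zero _ h.q_ne_zero)]
    simp only [f, Nat.add_sub_cancel_left]
    rw [h.higher.pow_d_symm h.q_ne_zero, smul_mul_assoc, map_smul, smul_mul_assoc, smul_smul, hc,
      mul_smul]
  rw [e1, h.deletionMap_eq_sum (M := A + B), Finset.sum_congr rfl fun N _ => hterm N,
    Finset.sum_sigma']
  · symm
    -- The antidiagonals below `A + B` contain the box `A × B`; the pairs outside the box contribute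
    -- zero, so it suffices to match nonzero terms.
    refine Finset.sum_bij_ne_zero (fun p _ _ => ⟨p.1 + p.2, p⟩) ?_ ?_ ?_ ?_
    · intro p hp _
      simp only [Finset.mem_product, Finset.mem_range] at hp
      simp only [Finset.mem_sigma, Finset.mem_range, Finset.HasAntidiagonal.mem_antidiagonal,
        and_true]
      omega
    · intro p _ _ p' _ _ e
      exact eq_of_heq (Sigma.mk.inj e).2
    · rintro ⟨N, p⟩ hp hne
      simp only [Finset.mem_sigma, Finset.mem_range, Finset.HasAntidiagonal.mem_antidiagonal] at hp
      obtain ⟨hp1, rfl⟩ := hp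
      refine ⟨p, ?_, hne, rfl⟩
      simp only [Finset.mem_product, Finset.mem_range]
      constructor <;> by_contra hc <;> exact hne (hf p (by omega))
    · intros; rfl
  · intro n hn
    rw [h.higher.mul]
    refine Finset.sum_eq_zero fun i hi => ?_
    rw [Finset.mem_range] at hi
    rcases le_or_gt A i with hi' | hi'
    · rw [hA i hi', map_zero, zero_mul]
    · rw [hB (n - i) (by omega), mul_zero]

end IsDeletionDatum

/-- The deletion map as a homomorphism of algebras. -/
noncomputable def deletionHom (h : IsDeletionDatum q σ δ d θ x) : R →ₐ[K] F :=
  AlgHom.ofLinearMap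
    { toFun := deletionMap q σ d θ x
      map_add' := h.deletionMap_add
      map_smul' := h.deletionMap_smul } h.deletionMap_one h.deletionMap_mul

theorem deletionHom_apply (h : IsDeletionDatum q σ δ d θ x) (a : R) :
    deletionHom h a = deletionMap q σ d θ x a := rfl

end DeletionHom

/-! ### Clearing and inverting denominators in the deletion map -/

section DeletionFractions

variable {K R F : Type*} [Field K] [Ring R] [Algebra K R] [DivisionRing F] [Algebra K F]
  {q : K} {σ : R ≃ₐ[K] R} {δ : R →ₗ[K] R} {d : ℕ → R →ₗ[K] R} {θ : R →ₐ[K] F} {x : F}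

namespace IsDeletionDatum

theorem d_d_eq_zero (h : IsDeletionDatum q σ δ d θ x) {n m : ℕ} {a : R} (ha : d (n + m) a = 0) :
    d n (d m a) = 0 := by
  rw [h.iterative, ha, smul_zero]

/-- Each `x` crossing `θ a` either cancels one `x⁻¹` on the right (the `σ`-term, lowering `k`) or
lowers the nilpotence order `M` (the `δ`-term). Hence `M + k` crossings are enough. -/
theorem pow_mul_mem (h : IsDeletionDatum q σ δ d θ x) {C : Subalgebra K F}
    (hC : ∀ a, θ a ∈ C) (hx : x ∈ C) (N : ℕ) : ∀ (M k : ℕ) (a : R), M + k ≤ N →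
    (∀ n, M < n → d n a = 0) → x ^ N * θ a * (x ^ k)⁻¹ ∈ C := by
  induction N with
  | zero =>
    intro M k a hk _
    obtain rfl : k = 0 := by omega
    simpa using hC a
  | succ N ih =>
    intro M k a hk ha
    cases k with
    | zero => simpa using mul_mem (pow_mem hx (N + 1)) (hC a)
    | succ k =>
      have e : x ^ (N + 1) * θ a * (x ^ (k + 1))⁻¹ =
          x ^ N * θ (σ a) * (x ^ k)⁻¹ + x ^ N * θ (δ a) * (x ^ (k + 1))⁻¹ := by
        have e1 : (x ^ k)⁻¹ = x * (x ^ (k + 1))⁻¹ := by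
          rw [pow_succ, mul_inv_rev, ← mul_assoc, mul_inv_cancel₀ h.x_ne_zero, one_mul]
        rw [e1, pow_succ x N, mul_assoc (x ^ N), h.comm]
        noncomm_ring
      rw [e]
      refine add_mem (ih M k _ (by omega) fun n hn => h.d_map_eq_zero (ha n hn)) ?_
      cases M with
      | zero =>
        rw [← h.higher.one, ha 1 one_pos, map_zero, mul_zero, zero_mul]
        exact zero_mem _
      | succ M =>
        refine ih M (k + 1) _ (by omega) fun n hn => ?_
        rw [← h.higher.one]
        exact h.d_d_eq_zero (ha _ (by omega))

theorem exists_pow_mul_mem (h : IsDeletionDatum q σ δ d θ x) {C : Subalgebra K F}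
    (hC : ∀ a, θ a ∈ C) (hx : x ∈ C) (a : R) : ∃ N : ℕ, x ^ N * deletionMap q σ d θ x a ∈ C := by
  obtain ⟨N, hN⟩ := h.nilpotent a
  have hN1 : ∀ n, N + 1 ≤ n → d n a = 0 := fun n hn => hN n (by omega)
  refine ⟨N, ?_⟩
  rw [h.deletionMap_eq_sum hN1, Finset.mul_sum]
  refine sum_mem fun n hn => ?_
  rw [Finset.mem_range] at hn
  rw [mul_smul_comm, ← mul_assoc]
  -- The `n`-th term has nilpotence order at most `N - n` and carries `x^{-n}`, so one exponent `N`
  -- serves all terms.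
  refine Subalgebra.smul_mem _ (h.pow_mul_mem hC hx N (N - n) n _ (by omega) fun i hi => ?_) _
  exact h.d_d_eq_zero (h.d_symm_eq_zero _ (hN1 _ (by omega)))

theorem exists_mul_pow_mem (h : IsDeletionDatum q σ δ d θ x) {C : Subalgebra K F}
    (hC : ∀ a, θ a ∈ C) (hx : x ∈ C) (a : R) : ∃ N : ℕ, deletionMap q σ d θ x a * x ^ N ∈ C := by
  obtain ⟨N, hN⟩ := h.nilpotent a
  refine ⟨N, ?_⟩
  rw [h.deletionMap_eq_sum hN, Finset.sum_mul]
  refine sum_mem fun n hn => ?_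
  rw [Finset.mem_range] at hn
  obtain ⟨k, rfl⟩ := Nat.exists_eq_add_of_lt hn
  rw [smul_mul_assoc, mul_assoc, add_assoc, pow_add,
    inv_mul_cancel_left₀ (pow_ne_zero n h.x_ne_zero)]
  exact Subalgebra.smul_mem _ (mul_mem (hC _) (pow_mem hx _)) _

/-- The term `n = 0` of `f(a)` is `θ a`, and the others involve elements of smaller nilpotence
order. Induction on that order inverts the change of variables without an explicit inverse formula.
-/
theorem mem_of_deletionMap_mem (h : IsDeletionDatum q σ δ d θ x) {C : Subalgebra K F}
    (hC : ∀ a, deletionMap q σ d θ x a ∈ C) (hx : x⁻¹ ∈ C) (a : R) : θ a ∈ C := by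
  obtain ⟨N, hN⟩ := h.nilpotent a
  induction N using Nat.strong_induction_on generalizing a with
  | _ N ih =>
  cases N with
  | zero =>
    have := hN 0 le_rfl
    rw [h.higher.zero, LinearMap.id_apply] at this
    rw [this, map_zero]
    exact zero_mem _
  | succ N =>
    have e := h.deletionMap_eq_sum hN
    rw [Finset.sum_range_succ'] at e
    have e0 : deletionCoeff q 0 • (θ (d 0 ((σ ^ 0).symm a)) * (x ^ 0)⁻¹) = θ a := by
      have e' : ((σ ^ 0).symm a) = a := by
        rw [AlgEquiv.symm_apply_eq, pow_zero, AlgEquiv.one_apply]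
      rw [e', h.higher.zero, deletionCoeff_zero, pow_zero, inv_one, mul_one, one_smul,
        LinearMap.id_apply]
    rw [e0, ← sub_eq_iff_eq_add'] at e
    rw [← e]
    refine sub_mem (hC a) (sum_mem fun n hn => ?_)
    refine Subalgebra.smul_mem _ (mul_mem (ih N (by omega) _ fun i hi => ?_) ?_) _
    · exact h.d_d_eq_zero (h.d_symm_eq_zero _ (hN _ (by omega)))
    · rw [← inv_pow]
      exact pow_mem hx _

/-- Powers of `x` stay independent over the image of the deletion map. -/
theorem eq_zero_of_eval_deletionHom (h : IsDeletionDatum q σ δ d θ x)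
    (hfree : ∀ p : Polynomial R, (p.map (θ : R →+* F)).eval x = 0 → p = 0)
    (p : Polynomial R) (hp : (p.map (deletionHom h : R →+* F)).eval x = 0) : p = 0 := by
  obtain ⟨M, hM⟩ : ∃ M, ∀ k n, M + 1 ≤ n → d n (p.coeff k) = 0 := by
    choose f hf using fun k => h.nilpotent (p.coeff k)
    refine ⟨p.support.sup f, fun k n hn => ?_⟩
    by_cases hk : k ∈ p.support
    · exact hf k n (by have := Finset.le_sup (f := f) hk; omega)
    · rw [Polynomial.notMem_support_iff.1 hk, map_zero]
  -- `P a` represents `f(a) x^M` for the coefficients `a` of `p`: it has no terms above degree `M`,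
  -- where its coefficient is `a` itself.
  let P : R → Polynomial R := fun a => ∑ n ∈ Finset.range (M + 1),
    Polynomial.monomial (M - n) (deletionCoeff q n • d n ((σ ^ n).symm a))
  have hPe : ∀ k, ((P (p.coeff k)).map (θ : R →+* F)).eval x =
      deletionMap q σ d θ x (p.coeff k) * x ^ M := by
    intro k
    rw [h.deletionMap_eq_sum (hM k), Polynomial.map_sum, Polynomial.eval_finsetSum,
      Finset.sum_mul]
    refine Finset.sum_congr rfl fun n hn => ?_
    obtain ⟨i, rfl⟩ := Nat.exists_eq_add_of_le (Nat.lt_succ_iff.1 (Finset.mem_range.1 hn))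
    rw [Polynomial.map_monomial, Polynomial.eval_monomial, Nat.add_sub_cancel_left,
      smul_mul_assoc, mul_assoc, pow_add, inv_mul_cancel_left₀ (pow_ne_zero n h.x_ne_zero),
      RingHom.coe_coe, map_smul, smul_mul_assoc]
  have hPtop : ∀ a, (P a).coeff M = a := by
    intro a
    have e' : ((σ ^ 0).symm a) = a := by
      rw [AlgEquiv.symm_apply_eq, pow_zero, AlgEquiv.one_apply]
    simp only [P, Polynomial.finsetSum_coeff, Polynomial.coeff_monomial]
    rw [Finset.sum_eq_single 0]
    · rw [if_pos (by omega), e', h.higher.zero, deletionCoeff_zero, one_smul, LinearMap.id_apply]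
    · intro n hn hn0
      rw [Finset.mem_range] at hn
      rw [if_neg (by omega)]
    · simp
  have hPhigh : ∀ a i, M < i → (P a).coeff i = 0 := by
    intro a i hi
    simp only [P, Polynomial.finsetSum_coeff, Polynomial.coeff_monomial]
    exact Finset.sum_eq_zero fun n _ => if_neg (by omega)
  have hQ := hfree (∑ k ∈ Finset.range (p.natDegree + 1), P (p.coeff k) * Polynomial.X ^ k) (by
    rw [Polynomial.map_sum, Polynomial.eval_finsetSum]
    have e : ∀ k, ((P (p.coeff k) * Polynomial.X ^ k).map (θ : R →+* F)).eval x =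
        deletionMap q σ d θ x (p.coeff k) * x ^ k * x ^ M := by
      intro k
      rw [Polynomial.map_mul, Polynomial.map_pow, Polynomial.map_X, Polynomial.eval_mul_X_pow,
        hPe, mul_assoc, mul_assoc, ← pow_add, ← pow_add, add_comm]
    rw [Finset.sum_congr rfl fun k _ => e k, ← Finset.sum_mul]
    rw [Polynomial.eval_map, Polynomial.eval₂_eq_sum_range] at hp
    have hp' : ∑ k ∈ Finset.range (p.natDegree + 1),
        deletionMap q σ d θ x (p.coeff k) * x ^ k = 0 := hp
    rw [hp', zero_mul])
  -- In this degree only the leading coefficient of `p` contributes.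
  have hc := congrArg (fun r => Polynomial.coeff r (M + p.natDegree)) hQ
  simp only [Polynomial.finsetSum_coeff, Polynomial.coeff_mul_X_pow', Polynomial.coeff_zero] at hc
  rw [Finset.sum_eq_single p.natDegree] at hc
  · rw [if_pos (by omega), Nat.add_sub_cancel, hPtop] at hc
    exact Polynomial.leadingCoeff_eq_zero.1 hc
  · intro k hk hkD
    rw [Finset.mem_range] at hk
    rw [if_pos (by omega), hPhigh _ _ (by omega)]
  · simp

theorem deletionHom_injective (h : IsDeletionDatum q σ δ d θ x)
    (hfree : ∀ p : Polynomial R, (p.map (θ : R →+* F)).eval x = 0 → p = 0) :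
    Function.Injective (deletionHom h) := by
  rw [injective_iff_map_eq_zero]
  intro a ha
  have := h.eq_zero_of_eval_deletionHom hfree (Polynomial.C a) (by simpa using ha)
  exact Polynomial.C_eq_zero.1 this

end IsDeletionDatum

end DeletionFractions

/-! ## Maps between completely prime spectra -/

section CSpec

variable {A B : Type*} [Ring A] [Ring B]

theorem isClosed_cspec_iff {s : Set (CSpec A)} : IsClosed s ↔ ∃ S, cspecZeroLocus S = s := by
  rw [← isOpen_compl_iff]
  change sᶜᶜ ∈ Set.range _ ↔ _
  rw [compl_compl, Set.mem_range]

/-- The contraction of completely prime ideals along a homomorphism of rings. -/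
def cspecComap (f : A →+* B) (P : CSpec B) : CSpec A :=
  ⟨TwoSidedIdeal.comap f P.1, by
    rw [TwoSidedIdeal.mem_comap, map_one]
    exact P.2.1, fun a b hab => by
    rw [TwoSidedIdeal.mem_comap, map_mul] at hab
    rw [TwoSidedIdeal.mem_comap, TwoSidedIdeal.mem_comap]
    exact P.2.2 _ _ hab⟩

theorem mem_cspecComap {f : A →+* B} {P : CSpec B} {a : A} :
    a ∈ (cspecComap f P).1 ↔ f a ∈ P.1 := TwoSidedIdeal.mem_comap f

theorem cspec_ext {P Q : CSpec A} (h : ∀ a, a ∈ P.1 ↔ a ∈ Q.1) : P = Q :=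
  Subtype.ext (TwoSidedIdeal.ext h)

theorem mul_unit_mem_cspec_iff (P : CSpec A) (u : Aˣ) {a : A} : a * u ∈ P.1 ↔ a ∈ P.1 :=
  ⟨fun h => by simpa using P.1.mul_mem_right _ (↑u⁻¹ : A) h, fun h => P.1.mul_mem_right _ _ h⟩

theorem unit_notMem_cspec (P : CSpec A) (u : Aˣ) : (u : A) ∉ P.1 := fun h =>
  P.2.1 ((mul_unit_mem_cspec_iff P u).1 (by rwa [one_mul]))

theorem mem_cspec_of_pow_mul_mem {P : CSpec A} {x a : A} (hx : x ∉ P.1) {n : ℕ}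
    (h : x ^ n * a ∈ P.1) : a ∈ P.1 := by
  induction n with
  | zero => simpa using h
  | succ n ih =>
    rw [pow_succ', mul_assoc] at h
    exact ih ((P.2.2 _ _ h).resolve_left hx)

theorem mem_cspec_of_mul_pow_mem {P : CSpec A} {x a : A} (hx : x ∉ P.1) {n : ℕ}
    (h : a * x ^ n ∈ P.1) : a ∈ P.1 := by
  induction n with
  | zero => simpa using h
  | succ n ih =>
    rw [pow_succ, ← mul_assoc] at h
    exact ih ((P.2.2 _ _ h).resolve_right hx)

/-- Every element of the target is, up to a unit on the right, in the image. -/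
def IsSurjectiveUpToUnits (f : A →+* B) : Prop := ∀ b, ∃ a, ∃ u : Bˣ, f a = b * u

theorem Function.Surjective.isSurjectiveUpToUnits {f : A →+* B} (hf : Function.Surjective f) :
    IsSurjectiveUpToUnits f := fun b => by
  obtain ⟨a, ha⟩ := hf b
  exact ⟨a, 1, by simpa using ha⟩

namespace IsSurjectiveUpToUnits

variable {f : A →+* B} (hf : IsSurjectiveUpToUnits f)
include hf

theorem cspecComap_le_iff {P Q : CSpec B} : cspecComap f P ≤ cspecComap f Q ↔ P ≤ Q := by
  constructor
  · intro h b hb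
    obtain ⟨a, u, e⟩ := hf b
    rw [← mul_unit_mem_cspec_iff Q u, ← e, ← mem_cspecComap]
    refine h (mem_cspecComap.2 ?_)
    rw [e]
    exact (mul_unit_mem_cspec_iff P u).2 hb
  · intro h a ha
    exact mem_cspecComap.2 (h (mem_cspecComap.1 ha))

theorem cspecComap_injective : Function.Injective (cspecComap f) := fun _ _ h =>
  le_antisymm (hf.cspecComap_le_iff.1 h.le) (hf.cspecComap_le_iff.1 h.ge)

/-- A closed set `V(S)` of the target is cut out by the elements of the source that map into `S` up
to units, since completely prime ideals do not see units. -/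
theorem isEmbedding_cspecComap : Topology.IsEmbedding (cspecComap f) := by
  refine ⟨⟨TopologicalSpace.ext_iff_isClosed.2 fun s => ?_⟩, hf.cspecComap_injective⟩
  rw [isClosed_induced_iff, isClosed_cspec_iff]
  constructor
  · rintro ⟨S, rfl⟩
    refine ⟨_, isClosed_cspec_iff.2 ⟨{a | ∃ b ∈ S, ∃ u : Bˣ, f a = b * u}, rfl⟩, ?_⟩
    ext P
    simp only [Set.mem_preimage, cspecZeroLocus, Set.mem_ofPred_eq]
    constructor
    · intro h b hb
      obtain ⟨a, u, e⟩ := hf b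
      have := mem_cspecComap.1 (h a ⟨b, hb, u, e⟩)
      rwa [e, mul_unit_mem_cspec_iff] at this
    · rintro h a ⟨b, hb, u, e⟩
      rw [mem_cspecComap, e, mul_unit_mem_cspec_iff]
      exact h b hb
  · rintro ⟨t, ht, rfl⟩
    obtain ⟨S, rfl⟩ := isClosed_cspec_iff.1 ht
    refine ⟨f '' S, ?_⟩
    ext P
    simp [cspecZeroLocus, mem_cspecComap]

end IsSurjectiveUpToUnits

theorem mem_range_cspecComap_of_surjective {f : A →+* B} (hf : Function.Surjective f)
    {P : CSpec A} : P ∈ Set.range (cspecComap f) ↔ ∀ a, f a = 0 → a ∈ P.1 := by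
  constructor
  · rintro ⟨Q, rfl⟩ a ha
    rw [mem_cspecComap, ha]
    exact Q.1.zero_mem
  · intro h
    let I : TwoSidedIdeal B := TwoSidedIdeal.mk' (f '' {p | p ∈ P.1})
      ⟨0, P.1.zero_mem, map_zero f⟩
      (by rintro _ _ ⟨a, ha, rfl⟩ ⟨b, hb, rfl⟩; exact ⟨a + b, P.1.add_mem ha hb, map_add f a b⟩)
      (by rintro _ ⟨a, ha, rfl⟩; exact ⟨-a, P.1.neg_mem ha, map_neg f a⟩)
      (by
        rintro b _ ⟨a, ha, rfl⟩
        obtain ⟨b, rfl⟩ := hf b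
        exact ⟨b * a, P.1.mul_mem_left _ _ ha, map_mul f b a⟩)
      (by
        rintro _ b ⟨a, ha, rfl⟩
        obtain ⟨b, rfl⟩ := hf b
        exact ⟨a * b, P.1.mul_mem_right _ _ ha, map_mul f a b⟩)
    have hI : ∀ a, f a ∈ I ↔ a ∈ P.1 := by
      intro a
      refine (TwoSidedIdeal.mem_mk' ..).trans ?_
      constructor
      · rintro ⟨p, hp, e⟩
        have := h (a - p) (by rw [map_sub, e, sub_self])
        simpa using P.1.add_mem this hp
      · exact fun ha => ⟨a, ha, rfl⟩
    refine ⟨⟨I, ?_, ?_⟩, cspec_ext fun a => mem_cspecComap.trans (hI a)⟩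
    · rw [← map_one f, hI]
      exact P.2.1
    · intro a b hab
      obtain ⟨a, rfl⟩ := hf a
      obtain ⟨b, rfl⟩ := hf b
      rw [← map_mul, hI] at hab
      rw [hI, hI]
      exact P.2.2 a b hab

/-- If two order and topological embeddings of the same space are intertwined by `ψ`, then `ψ`
restricts to an isomorphism between their ranges. -/
theorem exists_homeomorph_of_embeddings {X Y Z : Type*} [TopologicalSpace X]
    [TopologicalSpace Y] [TopologicalSpace Z] [LE X] [LE Y] [LE Z] {α : Z → X} {β : Z → Y}
    {ψ : X → Y} (hα : Topology.IsEmbedding α) (hβ : Topology.IsEmbedding β)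
    (hα' : ∀ z z', α z ≤ α z' ↔ z ≤ z') (hβ' : ∀ z z', β z ≤ β z' ↔ z ≤ z')
    (h : ∀ z, ψ (α z) = β z) {s : Set X} (hs : Set.range α = s) :
    ∃ e : s ≃ₜ (ψ '' s : Set Y), (∀ P, (e P : Y) = ψ P) ∧
      ∀ P P', (e P : Y) ≤ e P' ↔ (P : X) ≤ P' := by
  subst hs
  have hr : Set.range β = ψ '' Set.range α := by
    rw [← Set.range_comp]
    congr 1
    exact (funext h).symm
  let e : Set.range α ≃ₜ (ψ '' Set.range α : Set Y) :=
    hα.toHomeomorph.symm.trans (hβ.toHomeomorph.trans (Homeomorph.setCongr hr))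
  have he : ∀ z, (e (hα.toHomeomorph z) : Y) = β z := by
    intro z
    simp only [e, Homeomorph.trans_apply, Homeomorph.symm_apply_apply]
    rfl
  refine ⟨e, fun P => ?_, fun P P' => ?_⟩
  · obtain ⟨z, rfl⟩ := hα.toHomeomorph.surjective P
    rw [he]
    exact (h z).symm
  · obtain ⟨z, rfl⟩ := hα.toHomeomorph.surjective P
    obtain ⟨z', rfl⟩ := hα.toHomeomorph.surjective P'
    rw [he, he, hβ']
    exact (hα' z z').symm

end CSpec

/-! ## Localization at the powers of an element -/

/-- `T` is the left and right localization of `R` at the powers of `x`, inside `F`. -/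
structure IsPowLocalization {K F : Type*} [Field K] [DivisionRing F] [Algebra K F]
    (R T : Subalgebra K F) (x : F) : Prop where
  le : R ≤ T
  x_ne_zero : x ≠ 0
  x_mem : x ∈ R
  inv_mem : x⁻¹ ∈ T
  exists_pow_mul_mem : ∀ t ∈ T, ∃ n : ℕ, x ^ n * t ∈ R
  exists_mul_pow_mem : ∀ t ∈ T, ∃ n : ℕ, t * x ^ n ∈ R

namespace IsPowLocalization

variable {K F : Type*} [Field K] [DivisionRing F] [Algebra K F] {R T : Subalgebra K F} {x : F}
  (h : IsPowLocalization R T x)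

/-- The inclusion of `R` in its localization. -/
def incl : R →+* T := (Subalgebra.inclusion h.le : R →+* T)

theorem coe_incl (r : R) : (h.incl r : F) = r := rfl

/-- `x` as a unit of the localization. -/
def unit : Tˣ where
  val := ⟨x, h.le h.x_mem⟩
  inv := ⟨x⁻¹, h.inv_mem⟩
  val_inv := Subtype.ext (mul_inv_cancel₀ h.x_ne_zero)
  inv_val := Subtype.ext (inv_mul_cancel₀ h.x_ne_zero)

theorem coe_unit_pow (n : ℕ) : ((h.unit ^ n : Tˣ) : T) = (x ^ n : F) := by
  rw [Units.val_pow_eq_pow_val]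
  rfl

include h in
theorem inv_pow_mem (n : ℕ) : (x ^ n)⁻¹ ∈ T := by
  rw [← inv_pow]
  exact pow_mem h.inv_mem n

theorem isSurjectiveUpToUnits : IsSurjectiveUpToUnits h.incl := by
  rintro ⟨t, ht⟩
  obtain ⟨n, hn⟩ := h.exists_mul_pow_mem t ht
  refine ⟨⟨_, hn⟩, h.unit ^ n, Subtype.ext ?_⟩
  rw [coe_incl, Subalgebra.coe_mul, coe_unit_pow]

theorem exists_eq_pow_mul_mul_pow_of_le {P : TwoSidedIdeal R} (hxR : x ∈ R) {t : F} {p : R}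
    (hp : p ∈ P) {m n : ℕ} (e : (p : F) = x ^ m * t * x ^ n) {m' n' : ℕ}
    (hm : m ≤ m') (hn : n ≤ n') :
    ∃ p' ∈ P, (p' : F) = x ^ m' * t * x ^ n' := by
  obtain ⟨i, rfl⟩ := Nat.exists_eq_add_of_le' hm
  obtain ⟨k, rfl⟩ := Nat.exists_eq_add_of_le hn
  refine ⟨⟨x, hxR⟩ ^ i * p * ⟨x, hxR⟩ ^ k,
    P.mul_mem_right _ _ (P.mul_mem_left _ _ hp), ?_⟩
  simp only [Subalgebra.coe_mul, Subalgebra.coe_pow, e, pow_add, mul_assoc]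

/-- The extension of an ideal to the localization. -/
def extend (P : TwoSidedIdeal R) : TwoSidedIdeal T :=
  -- Denominators are allowed on both sides, so multiplication on one side only alters the exponent
  -- on that side.
  TwoSidedIdeal.mk' {t | ∃ p ∈ P, ∃ m n : ℕ, (p : F) = x ^ m * t * x ^ n}
    ⟨0, P.zero_mem, 0, 0, by simp⟩
    (by
      rintro s t ⟨p, hp, m, n, e⟩ ⟨p', hp', m', n', e'⟩
      obtain ⟨p₁, hp₁, e₁⟩ := exists_eq_pow_mul_mul_pow_of_le h.x_mem hp e
        (le_max_left m m') (le_max_left n n')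
      obtain ⟨p₂, hp₂, e₂⟩ := exists_eq_pow_mul_mul_pow_of_le h.x_mem hp' e'
        (le_max_right m m') (le_max_right n n')
      refine ⟨p₁ + p₂, P.add_mem hp₁ hp₂, max m m', max n n', ?_⟩
      rw [Subalgebra.coe_add, Subalgebra.coe_add, e₁, e₂, mul_add, add_mul])
    (by
      rintro t ⟨p, hp, m, n, e⟩
      exact ⟨-p, P.neg_mem hp, m, n, by simp [e]⟩)
    (by
      rintro b t ⟨p, hp, m, n, e⟩
      obtain ⟨M, hM⟩ := h.exists_pow_mul_mem _ (mul_mem b.2 (h.inv_pow_mem m))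
      refine ⟨⟨_, hM⟩ * p, P.mul_mem_left _ _ hp, M, n, ?_⟩
      rw [Subalgebra.coe_mul, Subalgebra.coe_mul, e]
      simp only [mul_assoc]
      rw [inv_mul_cancel_left₀ (pow_ne_zero m h.x_ne_zero)])
    (by
      rintro t b ⟨p, hp, m, n, e⟩
      obtain ⟨M, hM⟩ := h.exists_mul_pow_mem _ (mul_mem (h.inv_pow_mem n) b.2)
      refine ⟨p * ⟨_, hM⟩, P.mul_mem_right _ _ hp, m, M, ?_⟩
      rw [Subalgebra.coe_mul, Subalgebra.coe_mul, e]
      simp only [mul_assoc]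
      rw [mul_inv_cancel_left₀ (pow_ne_zero n h.x_ne_zero)])

theorem mem_extend {P : TwoSidedIdeal R} {t : T} :
    t ∈ h.extend P ↔ ∃ p ∈ P, ∃ m n : ℕ, (p : F) = x ^ m * t * x ^ n :=
  TwoSidedIdeal.mem_mk' ..

theorem incl_mem_extend_iff {P : CSpec R} (hx : (⟨x, h.x_mem⟩ : R) ∉ P.1) {r : R} :
    h.incl r ∈ h.extend P.1 ↔ r ∈ P.1 := by
  rw [mem_extend]
  constructor
  · rintro ⟨p, hp, m, n, e⟩
    have e' : p = ⟨x, h.x_mem⟩ ^ m * (r * ⟨x, h.x_mem⟩ ^ n) := by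
      refine Subtype.ext ?_
      rw [e, coe_incl]
      simp [mul_assoc]
    rw [e'] at hp
    exact mem_cspec_of_mul_pow_mem hx (mem_cspec_of_pow_mul_mem hx hp)
  · exact fun hr => ⟨r, hr, 0, 0, by simp [coe_incl]⟩

/-- Contraction identifies the completely prime ideals of the localization with those completely
prime ideals of `R` that do not contain `x`. -/
theorem range_cspecComap_incl :
    Set.range (cspecComap h.incl) = cspecPiece (⟨x, h.x_mem⟩ : R) 0 := by
  ext P
  have h0 : P ∈ cspecPiece (⟨x, h.x_mem⟩ : R) 0 ↔ (⟨x, h.x_mem⟩ : R) ∉ P.1 := by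
    simp [cspecPiece]
  rw [h0]
  constructor
  · rintro ⟨Q, rfl⟩ hx
    exact unit_notMem_cspec Q h.unit (mem_cspecComap.1 hx)
  · intro hx
    refine ⟨⟨h.extend P.1, ?_, ?_⟩, cspec_ext fun r =>
      mem_cspecComap.trans (h.incl_mem_extend_iff hx)⟩
    · rw [← map_one h.incl, h.incl_mem_extend_iff hx]
      exact P.2.1
    · intro a b hab
      obtain ⟨p, hp, m, n, e⟩ := h.mem_extend.1 hab
      obtain ⟨i, hi⟩ := h.exists_pow_mul_mem a a.2
      obtain ⟨k, hk⟩ := h.exists_mul_pow_mem b b.2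
      have hm : x ^ m * (x ^ i * a) ∈ R := mul_mem (pow_mem h.x_mem m) hi
      have hn : (b * x ^ k) * x ^ n ∈ R := mul_mem hk (pow_mem h.x_mem n)
      -- Powers of `x` commute with each other, so the powers clearing `a` and `b` can be moved
      -- outside `x^m a b x^n = p`.
      have key : (⟨_, hm⟩ : R) * ⟨_, hn⟩ ∈ P.1 := by
        have e' : (⟨_, hm⟩ : R) * ⟨_, hn⟩ = ⟨x, h.x_mem⟩ ^ i * p * ⟨x, h.x_mem⟩ ^ k := by
          refine Subtype.ext ?_
          simp only [Subalgebra.coe_mul, Subalgebra.coe_pow, e]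
          simp only [mul_assoc]
          rw [← mul_assoc (x ^ m), ← pow_add, ← mul_assoc (x ^ i), ← pow_add, ← pow_add, ← pow_add,
            add_comm m i, add_comm k n]
        rw [e']
        exact P.1.mul_mem_right _ _ (P.1.mul_mem_left _ _ hp)
      rcases P.2.2 _ _ key with h1 | h1
      · refine Or.inl (h.mem_extend.2 ⟨_, h1, m + i, 0, ?_⟩)
        rw [pow_zero, mul_one, pow_add, mul_assoc]
      · refine Or.inr (h.mem_extend.2 ⟨_, h1, 0, k + n, ?_⟩)
        rw [pow_zero, one_mul, pow_add, ← mul_assoc]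

end IsPowLocalization

/-! ## Fractions with denominators powers of the deleted variable -/

section SkewCommuting

variable {K T : Type*} [Field K] [Ring T] [Algebra K T]

theorem pow_mul_eq_smul {w s : T} {c : K} (h : w * s = c • (s * w)) (n : ℕ) :
    w ^ n * s = c ^ n • (s * w ^ n) := by
  induction n with
  | zero => simp
  | succ n ih =>
    rw [pow_succ, mul_assoc, h, mul_smul_comm, ← mul_assoc, ih, smul_mul_assoc, smul_smul,
      mul_assoc, pow_succ c, mul_comm (c ^ n)]

theorem mul_eq_inv_smul {w s : T} {c : K} (hc : c ≠ 0) (h : w * s = c • (s * w)) :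
    s * w = c⁻¹ • (w * s) := by
  rw [h, smul_smul, inv_mul_cancel₀ hc, one_smul]

end SkewCommuting

section Fractions

variable {K F : Type*} [Field K] [DivisionRing F] [Algebra K F]

/-- The elements `t` such that `x ^ n * t` lies in `C` for some `n`. -/
def leftFractions {C : Subalgebra K F} {x : F} (hx : x ∈ C) : Submodule K F where
  carrier := {t | ∃ n : ℕ, x ^ n * t ∈ C}
  zero_mem' := ⟨0, by simp⟩
  add_mem' := by
    rintro s t ⟨n, hn⟩ ⟨m, hm⟩
    refine ⟨n + m, ?_⟩
    rw [mul_add]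
    refine add_mem ?_ ?_
    · rw [add_comm, pow_add, mul_assoc]
      exact mul_mem (pow_mem hx _) hn
    · rw [pow_add, mul_assoc]
      exact mul_mem (pow_mem hx _) hm
  smul_mem' := by
    rintro c t ⟨n, hn⟩
    exact ⟨n, by rw [mul_smul_comm]; exact C.smul_mem hn c⟩

/-- The elements `t` such that `t * x ^ n` lies in `C` for some `n`. -/
def rightFractions {C : Subalgebra K F} {x : F} (hx : x ∈ C) : Submodule K F where
  carrier := {t | ∃ n : ℕ, t * x ^ n ∈ C}
  zero_mem' := ⟨0, by simp⟩
  add_mem' := by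
    rintro s t ⟨n, hn⟩ ⟨m, hm⟩
    refine ⟨n + m, ?_⟩
    rw [add_mul]
    refine add_mem ?_ ?_
    · rw [pow_add, ← mul_assoc]
      exact mul_mem hn (pow_mem hx _)
    · rw [add_comm, pow_add, ← mul_assoc]
      exact mul_mem hm (pow_mem hx _)
  smul_mem' := by
    rintro c t ⟨n, hn⟩
    exact ⟨n, by rw [smul_mul_assoc]; exact C.smul_mem hn c⟩

theorem mem_leftFractions {C : Subalgebra K F} {x : F} {hx : x ∈ C} {t : F} :
    t ∈ leftFractions hx ↔ ∃ n : ℕ, x ^ n * t ∈ C := Iff.rfl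

theorem mem_rightFractions {C : Subalgebra K F} {x : F} {hx : x ∈ C} {t : F} :
    t ∈ rightFractions hx ↔ ∃ n : ℕ, t * x ^ n ∈ C := Iff.rfl

section

variable {R : Type*} [Ring R] [Algebra K R] {q : K} {σ : R ≃ₐ[K] R} {δ : R →ₗ[K] R}
  {d : ℕ → R →ₗ[K] R} {θ : R →ₐ[K] F} {x : F} (h : IsDeletionDatum q σ δ d θ x)
  {C : Subalgebra K F} {S : Set F} (hC : ∀ a, θ a ∈ C) (hx : x ∈ C)
  (hS : ∀ s ∈ S, (∃ a, deletionMap q σ d θ x a = s) ∨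
    (s ∈ C ∧ ∃ c : K, c ≠ 0 ∧ s * x = c • (x * s)))
include h hC hx hS

/-- The fractions are stable under left multiplication by both kinds of generators: `x^n f(a) =
f(σ^n a) x^n`, whose denominators can be cleared, while a generator in `C` commutes with `x` up to a
scalar. -/
theorem IsDeletionDatum.exists_pow_mul_mem_of_adjoin {u : F} (hu : u ∈ Algebra.adjoin K S) :
    ∃ n : ℕ, x ^ n * u ∈ C := by
  refine mem_leftFractions.1 (adjoin_le_of_mul_mem_left (M := leftFractions hx)
    ⟨0, by simp⟩ ?_ hu)
  rintro s hs t ⟨n, hn⟩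
  rcases hS s hs with ⟨a, rfl⟩ | ⟨hsC, c, hc, e⟩
  · obtain ⟨N, hN⟩ := h.exists_pow_mul_mem hC hx ((σ ^ n) a)
    refine ⟨N + n, ?_⟩
    have e := h.pow_inv_mul_deletionMap n ((σ ^ n) a)
    have hxn := pow_ne_zero n h.x_ne_zero
    rw [AlgEquiv.symm_apply_apply, eq_mul_inv_iff_mul_eq₀ hxn, mul_assoc,
      inv_mul_eq_iff_eq_mul₀ hxn] at e
    rw [pow_add, mul_assoc, ← mul_assoc (x ^ n), ← e, mul_assoc, ← mul_assoc]
    exact mul_mem hN hn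
  · refine ⟨n, ?_⟩
    rw [← mul_assoc, pow_mul_eq_smul (mul_eq_inv_smul hc e), smul_mul_assoc, mul_assoc]
    exact C.smul_mem (mul_mem hsC hn) _

theorem IsDeletionDatum.exists_mul_pow_mem_of_adjoin {u : F} (hu : u ∈ Algebra.adjoin K S) :
    ∃ n : ℕ, u * x ^ n ∈ C := by
  refine mem_rightFractions.1 (adjoin_le_of_mul_mem_right (M := rightFractions hx)
    ⟨0, by simp⟩ ?_ hu)
  rintro s hs t ⟨n, hn⟩
  rcases hS s hs with ⟨a, rfl⟩ | ⟨hsC, c, hc, e⟩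
  · obtain ⟨N, hN⟩ := h.exists_mul_pow_mem hC hx ((σ ^ n).symm a)
    refine ⟨n + N, ?_⟩
    have e := h.pow_inv_mul_deletionMap n a
    have hxn := pow_ne_zero n h.x_ne_zero
    rw [eq_mul_inv_iff_mul_eq₀ hxn, mul_assoc, inv_mul_eq_iff_eq_mul₀ hxn] at e
    rw [pow_add, mul_assoc, ← mul_assoc (deletionMap q σ d θ x a), e, mul_assoc, ← mul_assoc]
    exact mul_mem hn hN
  · refine ⟨n, ?_⟩
    have e' := pow_mul_eq_smul (mul_eq_inv_smul hc e) n
    rw [mul_assoc, mul_eq_inv_smul (pow_ne_zero n (inv_ne_zero hc)) e', mul_smul_comm,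
      ← mul_assoc]
    exact C.smul_mem (mul_mem hn hsC) _

end

/-- The localization of an algebra that is normalised by `x`. -/
theorem exists_mul_pow_mem_of_mem_adjoin_inv {C : Subalgebra K F} {x : F} (hx0 : x ≠ 0)
    (hx : x ∈ C) (hn : ∀ u ∈ C, ∃ v ∈ C, u * x = x * v) {t : F}
    (ht : t ∈ Algebra.adjoin K (insert x⁻¹ (C : Set F))) : ∃ n : ℕ, t * x ^ n ∈ C := by
  have hpow : ∀ n : ℕ, ∀ u ∈ C, ∃ v ∈ C, u * x ^ n = x ^ n * v := by
    intro n
    induction n with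
    | zero => exact fun u hu => ⟨u, hu, by simp⟩
    | succ n ih =>
      intro u hu
      obtain ⟨v, hv, e⟩ := ih u hu
      obtain ⟨w, hw, e'⟩ := hn v hv
      exact ⟨w, hw, by rw [pow_succ, ← mul_assoc, e, mul_assoc, e', mul_assoc]⟩
  refine mem_rightFractions.1 (adjoin_le_of_mul_mem_right (M := rightFractions hx)
    ⟨0, by simp⟩ ?_ ht)
  rintro s hs t ⟨n, ht⟩
  rcases hs with rfl | hs
  · refine ⟨n + 1, ?_⟩
    rwa [pow_succ', mul_assoc, inv_mul_cancel_left₀ hx0]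
  · obtain ⟨v, hv, e⟩ := hpow n s hs
    refine ⟨n, ?_⟩
    rw [mul_assoc, e, ← mul_assoc]
    exact mul_mem ht hv

theorem exists_pow_mul_mem_of_mem_adjoin_inv {C : Subalgebra K F} {x : F} (hx0 : x ≠ 0)
    (hx : x ∈ C) (hn : ∀ u ∈ C, ∃ v ∈ C, x * u = v * x) {t : F}
    (ht : t ∈ Algebra.adjoin K (insert x⁻¹ (C : Set F))) : ∃ n : ℕ, x ^ n * t ∈ C := by
  have hpow : ∀ n : ℕ, ∀ u ∈ C, ∃ v ∈ C, x ^ n * u = v * x ^ n := by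
    intro n
    induction n with
    | zero => exact fun u hu => ⟨u, hu, by simp⟩
    | succ n ih =>
      intro u hu
      obtain ⟨v, hv, e⟩ := ih u hu
      obtain ⟨w, hw, e'⟩ := hn v hv
      exact ⟨w, hw, by rw [pow_succ', mul_assoc, e, ← mul_assoc, e', mul_assoc]⟩
  refine mem_leftFractions.1 (adjoin_le_of_mul_mem_left (M := leftFractions hx)
    ⟨0, by simp⟩ ?_ ht)
  rintro s hs t ⟨n, ht⟩
  rcases hs with rfl | hs
  · refine ⟨n + 1, ?_⟩
    rwa [pow_succ, mul_assoc, mul_inv_cancel_left₀ hx0]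
  · obtain ⟨v, hv, e⟩ := hpow n s hs
    refine ⟨n, ?_⟩
    rw [← mul_assoc, e, mul_assoc]
    exact mul_mem hv ht

end Fractions

/-! ### Twisted commutation relations checked on generators -/

section MapAdjoin

variable {K F : Type*} [Field K] [Ring F] [Algebra K F] {S : Set F}

/-- If `z θ(s) = θ(τ(s)) z` for the generators `s` of an algebra, the same holds for all its
elements. -/
theorem exists_mul_map_eq_of_adjoin {A : Subalgebra K F} (hA : A = Algebra.adjoin K S)
    (θ τ : A →ₐ[K] F) (z : F)
    (h : ∀ s (hs : s ∈ A), s ∈ S → ∃ b : A, (b : F) = τ ⟨s, hs⟩ ∧ z * θ ⟨s, hs⟩ = θ b * z)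
    (a : A) : ∃ b : A, (b : F) = τ a ∧ z * θ a = θ b * z := by
  subst hA
  obtain ⟨a, ha⟩ := a
  induction ha using Algebra.adjoin_induction with
  | mem s hs => exact h s _ hs
  | algebraMap r =>
    refine ⟨algebraMap K _ r, (τ.commutes r).symm, ?_⟩
    have e : θ ⟨algebraMap K F r, Subalgebra.algebraMap_mem _ r⟩ = algebraMap K F r := θ.commutes r
    rw [e, AlgHom.commutes, Algebra.commutes]
  | add s t hs ht hs' ht' =>
    obtain ⟨b, hb, eb⟩ := hs'
    obtain ⟨c, hc, ec⟩ := ht'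
    have e : ∀ φ : Algebra.adjoin K S →ₐ[K] F, φ ⟨s + t, add_mem hs ht⟩ = φ ⟨s, hs⟩ + φ ⟨t, ht⟩ :=
      fun φ => map_add φ ⟨s, hs⟩ ⟨t, ht⟩
    refine ⟨b + c, ?_, ?_⟩
    · rw [Subalgebra.coe_add, hb, hc, e]
    · rw [e, mul_add, eb, ec, map_add, add_mul]
  | mul s t hs ht hs' ht' =>
    obtain ⟨b, hb, eb⟩ := hs'
    obtain ⟨c, hc, ec⟩ := ht'
    have e : ∀ φ : Algebra.adjoin K S →ₐ[K] F, φ ⟨s * t, mul_mem hs ht⟩ = φ ⟨s, hs⟩ * φ ⟨t, ht⟩ :=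
      fun φ => map_mul φ ⟨s, hs⟩ ⟨t, ht⟩
    refine ⟨b * c, ?_, ?_⟩
    · rw [Subalgebra.coe_mul, hb, hc, e]
    · rw [e, ← mul_assoc, eb, mul_assoc, ec, map_mul, mul_assoc]

end MapAdjoin

/-! ## Homomorphisms from graphs, free extensions -/

section Graph

variable {K A B R ι : Type*} [Field K] [Ring A] [Algebra K A] [Ring B] [Algebra K B]
  [Ring R] [Algebra K R]

/-- A subalgebra of `A × B` that projects injectively to `A` is the graph of a homomorphism. -/
theorem exists_algHom_of_graph {C : Subalgebra K A} {w : ι → A × B} {S : Set ι}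
    (hC : C = Algebra.adjoin K ((fun i => (w i).1) '' S))
    (hinj : ∀ u ∈ Algebra.adjoin K (w '' S), u.1 = 0 → u = 0) :
    ∃ g : C →ₐ[K] B, ∀ i ∈ S, ∀ c : C, (c : A) = (w i).1 → g c = (w i).2 := by
  have hmap : (Algebra.adjoin K (w '' S)).map (AlgHom.fst K A B) = C := by
    rw [AlgHom.map_adjoin, hC, ← Set.image_comp]
    rfl
  let f : Algebra.adjoin K (w '' S) →ₐ[K] C :=
    ((AlgHom.fst K A B).comp (Subalgebra.val _)).codRestrict C fun u => by
      rw [← hmap]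
      exact ⟨u, u.2, rfl⟩
  have hf : Function.Bijective f := by
    constructor
    · rw [injective_iff_map_eq_zero]
      intro u hu
      exact Subtype.ext (hinj u u.2 (congrArg Subtype.val hu))
    · rintro ⟨c, hc⟩
      rw [← hmap] at hc
      obtain ⟨u, hu, rfl⟩ := hc
      exact ⟨⟨u, hu⟩, rfl⟩
  let e := AlgEquiv.ofBijective f hf
  refine ⟨(AlgHom.snd K A B).comp ((Algebra.adjoin K (w '' S)).val.comp e.symm.toAlgHom), ?_⟩
  intro i hi c hc
  have he : e.symm c = ⟨w i, Algebra.subset_adjoin (Set.mem_image_of_mem w hi)⟩ := by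
    rw [AlgEquiv.symm_apply_eq]
    exact Subtype.ext hc
  change ((e.symm c : Algebra.adjoin K (w '' S)) : A × B).2 = _
  rw [he]

theorem isLeftFree_range {f : R →ₐ[K] A} {x : A}
    (hf : ∀ p : Polynomial R, (p.map (f : R →+* A)).eval x = 0 → p = 0) :
    IsLeftFree f.range x := by
  intro p hp e
  obtain ⟨r, rfl⟩ := (Polynomial.mem_lifts (f := (f : R →+* A)) p).1
    ((Polynomial.lifts_iff_coeff_lifts p).2 hp)
  rw [hf r e, Polynomial.map_zero]

theorem IsOreExtension.eq_zero_of_eval {F : Type*} [Ring F] [Algebra K F] {R S : Subalgebra K F}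
    {x : F} {σ : R ≃ₐ[K] R} {δ : R →ₗ[K] R} (h : IsOreExtension R S x σ δ) (p : Polynomial R)
    (hp : (p.map (R.val : R →+* F)).eval x = 0) : p = 0 := by
  let r : ℕ →₀ R := Finsupp.onFinset p.support p.coeff
    fun k hk => Polynomial.mem_support_iff.2 hk
  have hr : r.sum (fun k a => (a : F) * x ^ k) = 0 := by
    rw [Finsupp.onFinset_sum _ (fun k => by simp), ← hp, Polynomial.eval_map,
      Polynomial.eval₂_eq_sum, Polynomial.sum]
    rfl
  have hr0 : r = 0 := (h.free 0 S.zero_mem).unique hr (by simp)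
  ext k
  have := DFunLike.congr_fun hr0 k
  rw [Polynomial.coeff_zero, ← Finsupp.zero_apply (M := R) (a := k), ← this]
  rfl

/-- A polynomial relation that holds after an injective homomorphism holds before it. -/
theorem eval_eq_zero_of_map_inclusion {F : Type*} [Ring F] [Algebra K F] {R S : Subalgebra K F}
    (hRS : R ≤ S) {θ : S →ₐ[K] A} (hθ : Function.Injective θ) (Y : S) (p : Polynomial R)
    (hp : (p.map ((θ.comp (Subalgebra.inclusion hRS) : R →ₐ[K] A) : R →+* A)).eval (θ Y) = 0) :
    (p.map (R.val : R →+* F)).eval (Y : F) = 0 := by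
  have h1 : θ (p.eval₂ (Subalgebra.inclusion hRS : R →+* S) Y) = 0 := by
    rw [Polynomial.eval_map, Polynomial.eval₂_eq_sum, Polynomial.sum] at hp
    rw [Polynomial.eval₂_eq_sum, Polynomial.sum, map_sum, ← hp]
    exact Finset.sum_congr rfl fun k _ => by rw [map_mul, map_pow]; rfl
  have h2 := congrArg S.val (hθ (h1.trans (map_zero θ).symm))
  rw [map_zero, Polynomial.eval₂_eq_sum, Polynomial.sum, map_sum] at h2
  rw [Polynomial.eval_map, Polynomial.eval₂_eq_sum, Polynomial.sum, ← h2]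
  exact Finset.sum_congr rfl fun k _ => by rw [map_mul, map_pow]; rfl

end Graph

/-! ## The inductive structure of the algebras `A^{(j)}` -/

namespace QuantumNilpotent

variable {K F : Type*} [Field K] [DivisionRing F] [Algebra K F] {N : ℕ}
  (D : QuantumNilpotent K F N)

theorem alg_eq_lowerAlg (j : ℕ) : D.alg j = lowerAlg K (D.gens j) (N + 1) := by
  have h : Set.Icc 1 N = Set.Ico 1 (N + 1) := by
    ext l
    simp only [Set.mem_Icc, Set.mem_Ico]
    omega
  rw [alg, h, lowerAlg]

theorem gens_last : D.gens (N + 1) = D.X := by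
  rw [gens, if_pos (Nat.lt_succ_self N)]

theorem gens_eq_deleteStep {j : ℕ} (hj : j ≤ N) :
    D.gens j = D.deleteStep j (D.gens (j + 1)) := by
  rw [gens, if_neg (by omega)]

theorem gens_eq_of_le {j l : ℕ} (hj : j ≤ N) (hl : j ≤ l) : D.gens j l = D.gens (j + 1) l := by
  rw [D.gens_eq_deleteStep hj, deleteStep, dif_neg (by simp; omega)]

variable {D}

namespace IsTransport

variable {i : ℕ} {x : ℕ → F} {θ θ' : lowerAlg K D.X i →ₐ[K] F}

theorem unique (h : D.IsTransport i x θ) (h' : D.IsTransport i x θ') : θ = θ' := by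
  refine AlgHom.adjoin_ext ?_
  rintro _ ⟨l, hl, rfl⟩
  exact (h l hl).trans (h' l hl).symm

theorem transport_eq (h : D.IsTransport i x θ) (a : lowerAlg K D.X i) :
    D.transport i x a = θ a := by
  have hex : ∃ θ : lowerAlg K D.X i →ₐ[K] F, D.IsTransport i x θ := ⟨θ, h⟩
  rw [transport, dif_pos hex, hex.choose_spec.unique h]

theorem range_eq (h : D.IsTransport i x θ) : θ.range = lowerAlg K x i := by
  apply le_antisymm
  · rintro _ ⟨⟨a, ha⟩, rfl⟩
    change θ ⟨a, ha⟩ ∈ _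
    induction ha using Algebra.adjoin_induction with
    | mem s hs =>
      obtain ⟨l, hl, rfl⟩ := hs
      exact (h l hl).symm ▸ mem_lowerAlg K x hl
    | algebraMap r =>
      have : θ ⟨algebraMap K F r, Subalgebra.algebraMap_mem _ r⟩ = algebraMap K F r :=
        θ.commutes r
      rw [this]
      exact Subalgebra.algebraMap_mem _ r
    | add a b ha hb ha' hb' =>
      have : θ ⟨a + b, add_mem ha hb⟩ = θ ⟨a, ha⟩ + θ ⟨b, hb⟩ := map_add θ ⟨a, ha⟩ ⟨b, hb⟩
      rw [this]
      exact add_mem ha' hb'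
    | mul a b ha hb ha' hb' =>
      have : θ ⟨a * b, mul_mem ha hb⟩ = θ ⟨a, ha⟩ * θ ⟨b, hb⟩ := map_mul θ ⟨a, ha⟩ ⟨b, hb⟩
      rw [this]
      exact mul_mem ha' hb'
  · refine Algebra.adjoin_le ?_
    rintro _ ⟨l, hl, rfl⟩
    exact ⟨_, h l hl⟩

theorem restrict {i j : ℕ} {x : ℕ → F} {θ : lowerAlg K D.X j →ₐ[K] F} (h : D.IsTransport j x θ)
    (hij : i ≤ j) :
    D.IsTransport i x (θ.comp (Subalgebra.inclusion (lowerAlg_mono K D.X hij))) :=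
  fun l hl => h l ⟨hl.1, hl.2.trans_le hij⟩

end IsTransport

theorem σ_gen_eq {j l : ℕ} (hj2 : 2 ≤ j) (hjN : j ≤ N) (hl : l ∈ Set.Ico 1 j) :
    D.σ j ⟨D.X l, mem_lowerAlg K D.X hl⟩ = D.lam j l • ⟨D.X l, mem_lowerAlg K D.X hl⟩ :=
  Subtype.ext (D.σ_gen j hj2 hjN l hl)

variable (D) in
/-- The shape of `A^{(j)}`: the algebra `A_{j-1}` embeds by `θ`, and the remaining variables are
adjoined by Ore extensions without derivations. -/
structure IsLevel (j : ℕ) (θ : lowerAlg K D.X j →ₐ[K] F) : Prop where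
  inj : Function.Injective θ
  transport : D.IsTransport j (D.gens j) θ
  comm : ∀ m, j ≤ m → m ≤ N → ∀ i ∈ Set.Ico 1 m,
    D.gens j m * D.gens j i = D.lam m i • (D.gens j i * D.gens j m)
  free : ∀ m, j ≤ m → m ≤ N → IsLeftFree (lowerAlg K (D.gens j) m) (D.gens j m)

theorem lam_ne_zero {i l : ℕ} (hi : i ∈ Set.Icc 1 N) (hl : l ∈ Set.Icc 1 N) : D.lam i l ≠ 0 :=
  left_ne_zero_of_mul_eq_one (D.lam_antisymm i hi l hl)

variable (D) in
theorem isLevel_last : D.IsLevel (N + 1) (lowerAlg K D.X (N + 1)).val where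
  inj := Subtype.val_injective
  transport l hl := by rw [D.gens_last]; rfl
  comm m h1 h2 := by omega
  free m h1 h2 := by omega

/-- The restriction of `θ_{j+1} : A_j → F` to `A_{j-1}`. -/
noncomputable def lowerHom {j : ℕ} (θ : lowerAlg K D.X (j + 1) →ₐ[K] F) :
    lowerAlg K D.X j →ₐ[K] F :=
  θ.comp (Subalgebra.inclusion (lowerAlg_mono K D.X (Nat.le_succ j)))

namespace IsLevel

variable {j : ℕ} {θ : lowerAlg K D.X (j + 1) →ₐ[K] F} (H : D.IsLevel (j + 1) θ)
  (hj2 : 2 ≤ j) (hjN : j ≤ N)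
include H

theorem lowerHom_transport : D.IsTransport j (D.gens (j + 1)) (lowerHom θ) :=
  H.transport.restrict (Nat.le_succ j)

theorem lowerHom_mem {m : ℕ} (hm : j ≤ m) (a : lowerAlg K D.X j) :
    lowerHom θ a ∈ lowerAlg K (D.gens (j + 1)) m := by
  refine lowerAlg_mono K _ hm ?_
  rw [← H.lowerHom_transport.range_eq]
  exact ⟨a, rfl⟩

/-- Later variables act on the image of `A_{j-1}` through their automorphisms. -/
theorem exists_mul_lowerHom {l : ℕ} (hl : j + 1 ≤ l) (hlN : l ≤ N) (a : lowerAlg K D.X j) :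
    ∃ b : lowerAlg K D.X j,
      (b : F) = D.σ l (Subalgebra.inclusion (lowerAlg_mono K D.X (Nat.le_of_succ_le hl)) a) ∧
      D.gens (j + 1) l * lowerHom θ a = lowerHom θ b * D.gens (j + 1) l := by
  refine exists_mul_map_eq_of_adjoin (A := lowerAlg K D.X j) (S := D.X '' Set.Ico 1 j) rfl
    (lowerHom θ) ((lowerAlg K D.X l).val.comp ((D.σ l).toAlgHom.comp
      (Subalgebra.inclusion (lowerAlg_mono K D.X (Nat.le_of_succ_le hl)))))
    (D.gens (j + 1) l) ?_ a
  rintro _ _ ⟨i, hi, rfl⟩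
  have hil : i ∈ Set.Ico 1 l := ⟨hi.1, by have := hi.2; omega⟩
  refine ⟨D.lam l i • ⟨D.X i, mem_lowerAlg K D.X hi⟩, ?_, ?_⟩
  · exact (D.σ_gen l (by have := hi.1; have := hi.2; omega) hlN i hil).symm
  · have e := H.lowerHom_transport i hi
    rw [map_smul, e, H.comm l hl hlN i hil, smul_mul_assoc]

include hj2 hjN

/-- Freeness of `A_j` over `A_{j-1}` is carried into `F` by the injectivity of `θ` on all of `A_j`.
-/
theorem eval_lowerHom (p : Polynomial (lowerAlg K D.X j))
    (hp : (p.map (lowerHom θ : _ →+* F)).eval (D.gens (j + 1) j) = 0) : p = 0 := by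
  refine (D.ore j hj2 hjN).eq_zero_of_eval p ?_
  refine eval_eq_zero_of_map_inclusion (lowerAlg_mono K D.X (Nat.le_succ j)) H.inj
    ⟨D.X j, (D.ore j hj2 hjN).var_mem⟩ p ?_
  have hY : θ ⟨D.X j, (D.ore j hj2 hjN).var_mem⟩ = D.gens (j + 1) j :=
    H.transport j ⟨by omega, by omega⟩
  rw [hY]
  exact hp

theorem gens_ne_zero : D.gens (j + 1) j ≠ 0 := fun h0 =>
  Polynomial.X_ne_zero (H.eval_lowerHom hj2 hjN Polynomial.X (by simpa using h0))

theorem isDeletionDatum : IsDeletionDatum (D.q j) (D.σ j) (D.δ j) (D.d j) (lowerHom θ)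
    (D.gens (j + 1) j) where
  q_ne_zero := D.q_ne_zero j hj2 hjN
  q_ne_one := D.q_ne_one j hj2 hjN
  higher := D.higher j hj2 hjN
  nilpotent := D.nilpotent j hj2 hjN
  iterative := D.iterative j hj2 hjN
  x_ne_zero := H.gens_ne_zero hj2 hjN
  comm a := by
    let ι := Subalgebra.inclusion (lowerAlg_mono K D.X (Nat.le_succ j))
    let Y : lowerAlg K D.X (j + 1) := ⟨D.X j, (D.ore j hj2 hjN).var_mem⟩
    have hY : θ Y = D.gens (j + 1) j := H.transport j ⟨by omega, by omega⟩
    have e : Y * ι a = ι (D.σ j a) * Y + ι (D.δ j a) :=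
      Subtype.ext ((D.ore j hj2 hjN).comm a)
    have := congrArg θ e
    rw [map_mul, map_add, map_mul, hY] at this
    exact this

/-- This ties the recursive definition of the variables to the deletion homomorphism, whose
properties then become relations among them. -/
theorem gens_of_lt {l : ℕ} (hl : l ∈ Set.Ico 1 j) :
    D.gens j l = deletionHom (H.isDeletionDatum hj2 hjN) ⟨D.X l, mem_lowerAlg K D.X hl⟩ := by
  rw [D.gens_eq_deleteStep hjN, deleteStep, dif_pos hl, deletionHom_apply, deletionMap]
  refine finsum_congr fun n => ?_
  rw [H.lowerHom_transport.transport_eq]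
  rfl

theorem deletionHom_transport :
    D.IsTransport j (D.gens j) (deletionHom (H.isDeletionDatum hj2 hjN)) :=
  fun _ hl => (H.gens_of_lt hj2 hjN hl).symm

/-- In the `n`-th summand of `y_i`, the later variable passes `d_n` of the generator with factor
`λ_{m,j}^n λ_{m,i}`, by `σ_d`, and passes `x^{-n}` with factor `λ_{m,j}^{-n}`. What remains is
`λ_{m,i}`, the same for every `n`. -/
theorem comm_of_lt {m i : ℕ} (hm : j < m) (hmN : m ≤ N) (hi : i ∈ Set.Ico 1 j) :
    D.gens j m * D.gens j i = D.lam m i • (D.gens j i * D.gens j m) := by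
  have h := H.isDeletionDatum hj2 hjN
  have hm' : j + 1 ≤ m := hm
  have hl0 : D.lam m j ≠ 0 := lam_ne_zero ⟨by omega, hmN⟩ ⟨by omega, hjN⟩
  rw [D.gens_eq_of_le hjN hm.le, H.gens_of_lt hj2 hjN hi, deletionHom_apply]
  set a : lowerAlg K D.X j := ⟨D.X i, mem_lowerAlg K D.X hi⟩ with ha
  set x := D.gens (j + 1) j
  set z := D.gens (j + 1) m
  obtain ⟨M, hM⟩ := h.nilpotent a
  rw [h.deletionMap_eq_sum hM, Finset.mul_sum, Finset.sum_mul, Finset.smul_sum]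
  refine Finset.sum_congr rfl fun n _ => ?_
  have hzx : z * x = D.lam m j • (x * z) := H.comm m hm' hmN j ⟨by omega, hm⟩
  have hpow : ∀ n : ℕ, (D.σ j ^ n) a = D.lam j i ^ n • a := by
    intro n
    induction n with
    | zero => simp
    | succ n ih =>
      rw [pow_succ', AlgEquiv.mul_apply, ih, map_smul, σ_gen_eq hj2 hjN hi, smul_smul, pow_succ]
  have hsymm : (D.σ j ^ n).symm a = (D.lam j i ^ n)⁻¹ • a := by
    rw [AlgEquiv.symm_apply_eq, map_smul, hpow, smul_smul, inv_mul_cancel₀, one_smul]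
    exact pow_ne_zero _ (lam_ne_zero ⟨by omega, hjN⟩ ⟨hi.1, by have := hi.2; omega⟩)
  have hd : z * lowerHom θ (D.d j n a) =
      (D.lam m j ^ n * D.lam m i) • (lowerHom θ (D.d j n a) * z) := by
    obtain ⟨b, hb, eb⟩ := H.exists_mul_lowerHom hm' hmN (D.d j n a)
    have hσ := D.σ_d j hj2 m hm' hmN n a (D.lam m i • a)
      (D.σ_gen m (by omega) hmN i ⟨hi.1, by have := hi.2; omega⟩).symm
    have hb' : b = (D.lam m j ^ n * D.lam m i) • D.d j n a := by
      refine Subtype.ext ?_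
      rw [hb, hσ, map_smul, mul_smul]
      rfl
    rw [eb, hb', map_smul, smul_mul_assoc]
  have hxn : x ^ n ≠ 0 := pow_ne_zero n h.x_ne_zero
  have hz : z * (x ^ n)⁻¹ = (D.lam m j ^ n)⁻¹ • ((x ^ n)⁻¹ * z) := by
    have e : x ^ n * z = (D.lam m j)⁻¹ ^ n • (z * x ^ n) :=
      pow_mul_eq_smul (mul_eq_inv_smul hl0 hzx) n
    rw [mul_inv_eq_iff_eq_mul₀ hxn, smul_mul_assoc, mul_assoc, ← inv_pow]
    rw [← mul_smul_comm, ← e, inv_mul_cancel_left₀ hxn]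
  rw [hsymm, map_smul, map_smul]
  simp only [smul_mul_assoc, mul_smul_comm]
  rw [← mul_assoc, hd, smul_mul_assoc, mul_assoc, hz, mul_smul_comm, smul_smul, ← mul_assoc]
  simp only [smul_smul]
  congr 1
  field_simp

theorem comm_pred {m i : ℕ} (hm : j ≤ m) (hmN : m ≤ N) (hi : i ∈ Set.Ico 1 m) :
    D.gens j m * D.gens j i = D.lam m i • (D.gens j i * D.gens j m) := by
  rcases lt_or_ge i j with hij | hij
  · rcases hm.eq_or_lt with rfl | hjm
    · rw [H.gens_of_lt hj2 hjN hi, D.gens_eq_of_le hjN le_rfl, deletionHom_apply,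
        (H.isDeletionDatum hj2 hjN).mul_deletionMap, σ_gen_eq hj2 hjN hi,
        (H.isDeletionDatum hj2 hjN).deletionMap_smul, smul_mul_assoc]
    · exact H.comm_of_lt hj2 hjN hjm hmN ⟨hi.1, hij⟩
  · rw [D.gens_eq_of_le hjN hij, D.gens_eq_of_le hjN hm]
    exact H.comm m (by have := hi.2; omega) hmN i hi

theorem gens_cases {m : ℕ} (hm : m ≤ N + 1) {s : F}
    (hs : s ∈ D.gens j '' Set.Ico 1 m) :
    (∃ a, deletionMap (D.q j) (D.σ j) (D.d j) (lowerHom θ) (D.gens (j + 1) j) a = s) ∨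
    (s ∈ lowerAlg K (D.gens (j + 1)) m ∧
      ∃ c : K, c ≠ 0 ∧ s * D.gens (j + 1) j = c • (D.gens (j + 1) j * s)) := by
  obtain ⟨i, hi, rfl⟩ := hs
  rcases lt_or_ge i j with hij | hij
  · exact Or.inl ⟨_, (H.gens_of_lt hj2 hjN ⟨hi.1, hij⟩).symm⟩
  · rw [D.gens_eq_of_le hjN hij]
    refine Or.inr ⟨mem_lowerAlg K _ hi, ?_⟩
    rcases hij.eq_or_lt with rfl | hij
    · exact ⟨1, one_ne_zero, (one_smul _ _).symm⟩
    · have hiN : i ≤ N := by have := hi.2; omega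
      exact ⟨D.lam i j, lam_ne_zero ⟨hi.1, hiN⟩ ⟨by omega, hjN⟩,
        H.comm i hij hiN j ⟨by omega, hij⟩⟩

theorem exists_pow_mul_mem {m : ℕ} (hjm : j < m) (hm : m ≤ N + 1) {u : F}
    (hu : u ∈ lowerAlg K (D.gens j) m) :
    ∃ n : ℕ, D.gens (j + 1) j ^ n * u ∈ lowerAlg K (D.gens (j + 1)) m :=
  (H.isDeletionDatum hj2 hjN).exists_pow_mul_mem_of_adjoin (H.lowerHom_mem hjm.le)
    (mem_lowerAlg K _ ⟨by omega, hjm⟩) (fun _ hs => H.gens_cases hj2 hjN hm hs) hu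

theorem exists_mul_pow_mem {m : ℕ} (hjm : j < m) (hm : m ≤ N + 1) {u : F}
    (hu : u ∈ lowerAlg K (D.gens j) m) :
    ∃ n : ℕ, u * D.gens (j + 1) j ^ n ∈ lowerAlg K (D.gens (j + 1)) m :=
  (H.isDeletionDatum hj2 hjN).exists_mul_pow_mem_of_adjoin (H.lowerHom_mem hjm.le)
    (mem_lowerAlg K _ ⟨by omega, hjm⟩) (fun _ hs => H.gens_cases hj2 hjN hm hs) hu

/-- For `m = j` this is `eq_zero_of_eval_deletionHom`. For `m > j` a relation is multiplied on the
left by a power of `x_j` clearing all its coefficients, and becomes one between the previous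
variables. -/
theorem free_pred {m : ℕ} (hjm : j ≤ m) (hm : m ≤ N) :
    IsLeftFree (lowerAlg K (D.gens j) m) (D.gens j m) := by
  have h := H.isDeletionDatum hj2 hjN
  rw [D.gens_eq_of_le hjN hjm]
  rcases hjm.eq_or_lt with rfl | hjm
  · rw [← (H.deletionHom_transport hj2 hjN).range_eq]
    exact isLeftFree_range (h.eq_zero_of_eval_deletionHom (H.eval_lowerHom hj2 hjN))
  · intro p hp e
    set x := D.gens (j + 1) j with hx
    have hxm : x ∈ lowerAlg K (D.gens (j + 1)) m := mem_lowerAlg K _ ⟨by omega, hjm⟩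
    choose f hf using fun k => H.exists_pow_mul_mem hj2 hjN hjm (by omega) (hp k)
    set M := p.support.sup f
    have hM : ∀ k, x ^ M * p.coeff k ∈ lowerAlg K (D.gens (j + 1)) m := by
      intro k
      by_cases hk : k ∈ p.support
      · obtain ⟨i, hi⟩ := Nat.exists_eq_add_of_le' (Finset.le_sup (f := f) hk)
        rw [show M = i + f k from hi, pow_add, mul_assoc]
        exact mul_mem (pow_mem hxm i) (hf k)
      · rw [Polynomial.notMem_support_iff.1 hk, mul_zero]
        exact zero_mem _
    have key := H.free m hjm hm (Polynomial.C (x ^ M) * p)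
      (fun k => by rw [Polynomial.coeff_C_mul]; exact hM k)
      (by rw [Polynomial.eval_C_mul, e, mul_zero])
    refine (mul_eq_zero.1 key).resolve_left ?_
    exact Polynomial.C_ne_zero.2 (pow_ne_zero M h.x_ne_zero)

/-- Deleting one derivation. -/
theorem pred : D.IsLevel j (deletionHom (H.isDeletionDatum hj2 hjN)) where
  inj := (H.isDeletionDatum hj2 hjN).deletionHom_injective (H.eval_lowerHom hj2 hjN)
  transport := H.deletionHom_transport hj2 hjN
  comm _ h1 h2 _ hi := H.comm_pred hj2 hjN h1 h2 hi
  free _ h1 h2 := H.free_pred hj2 hjN h1 h2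

end IsLevel

variable (D) in
theorem exists_isLevel {j : ℕ} (hj2 : 2 ≤ j) (hjN : j ≤ N + 1) : ∃ θ, D.IsLevel j θ := by
  obtain ⟨k, hk⟩ := Nat.exists_eq_add_of_le hjN
  induction k generalizing j with
  | zero =>
    obtain rfl : j = N + 1 := by omega
    exact ⟨_, D.isLevel_last⟩
  | succ k ih =>
    obtain ⟨θ, H⟩ := ih (j := j + 1) (by omega) (by omega) (by omega)
    exact ⟨_, H.pred hj2 (by omega)⟩

end QuantumNilpotent

namespace QuantumNilpotent

variable {K F : Type*} [Field K] [DivisionRing F] [Algebra K F] {N : ℕ}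
  {D : QuantumNilpotent K F N}

/-! ## The homomorphism `g_j` -/

section Pullback

variable (D) (j : ℕ) (hj : j ∈ Set.Icc 1 N)

/-- The projection `A^{(j+1)} → A^{(j+1)}/⟨x_j⟩`. -/
noncomputable def quotMap : D.alg (j + 1) →ₐ[K] D.Quot j hj :=
  RingCon.mkₐ K (D.varIdeal j hj).ringCon

theorem quotMap_surjective : Function.Surjective (D.quotMap j hj) :=
  RingCon.mk'_surjective _

theorem quotMap_eq_zero_iff (a : D.alg (j + 1)) :
    D.quotMap j hj a = 0 ↔ a ∈ D.varIdeal j hj :=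
  RingCon.eq _

theorem quotMap_gen : D.quotMap j hj (D.gen (j + 1) j hj) = 0 :=
  (D.quotMap_eq_zero_iff j hj _).2 (TwoSidedIdeal.subset_span rfl)

open Classical in
/-- The pairs `(y_i, x_i + ⟨x_j⟩)`. -/
noncomputable def graphGen (i : ℕ) : F × D.Quot j hj :=
  (D.gens j i, if hi : i ∈ Set.Icc 1 N then D.quotMap j hj (D.gen (j + 1) i hi) else 0)

variable {D j hj}

theorem graphGen_snd {i : ℕ} (hi : i ∈ Set.Icc 1 N) :
    (D.graphGen j hj i).2 = D.quotMap j hj (D.gen (j + 1) i hi) := dif_pos hi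

namespace IsLevel

variable {θ : lowerAlg K D.X (j + 1) →ₐ[K] F} (H : D.IsLevel (j + 1) θ) (hj2 : 2 ≤ j)
include H hj2

theorem graphGen_comm {m i : ℕ} (hm : j ≤ m) (hmN : m ≤ N) (hi : i ∈ Set.Ico 1 m) :
    D.graphGen j hj m * D.graphGen j hj i =
      D.lam m i • (D.graphGen j hj i * D.graphGen j hj m) := by
  refine Prod.ext (H.comm_pred hj2 hj.2 hm hmN hi) ?_
  have hi' : i ∈ Set.Icc 1 N := ⟨hi.1, by have := hi.2; omega⟩
  have hm' : m ∈ Set.Icc 1 N := ⟨by omega, hmN⟩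
  rw [Prod.snd_mul, Prod.smul_snd, Prod.snd_mul, graphGen_snd hi', graphGen_snd hm']
  rcases hm.eq_or_lt with rfl | hm
  -- For `m = j` the old variables need not commute up to scalars, but `x_j` is zero in the quotient
  -- and the derivation does no harm.
  · rw [quotMap_gen, zero_mul, mul_zero, smul_zero]
  · rw [← map_mul, ← map_mul, ← map_smul]
    exact congrArg _ (Subtype.ext (H.comm m hm hmN i hi))

/-- Below `j` the pairs come from `A_{j-1}` through a map whose first component, the deletion
homomorphism, is injective. Adding a variable keeps the property: elements become polynomials in the
new pair, and freeness in the first component kills the first coordinates of all coefficients. -/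
theorem eq_zero_of_graphGen {m : ℕ} (hm : j ≤ m) (hmN : m ≤ N + 1) :
    ∀ u ∈ lowerAlg K (D.graphGen j hj) m, u.1 = 0 → u = 0 := by
  induction m, hm using Nat.le_induction with
  | base =>
    have hmem : ∀ a, lowerHom θ a ∈ D.alg (j + 1) := fun a => by
      rw [D.alg_eq_lowerAlg]
      exact H.lowerHom_mem (by have := hj.2; omega) a
    let φ : lowerAlg K D.X j →ₐ[K] F × D.Quot j hj :=
      (deletionHom (H.isDeletionDatum hj2 hj.2)).prod
        ((D.quotMap j hj).comp ((lowerHom θ).codRestrict (D.alg (j + 1)) hmem))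
    have hle : lowerAlg K (D.graphGen j hj) j ≤ φ.range := by
      refine Algebra.adjoin_le ?_
      rintro _ ⟨l, hl, rfl⟩
      refine ⟨⟨D.X l, mem_lowerAlg K D.X hl⟩, Prod.ext (H.deletionHom_transport hj2 hj.2 l hl) ?_⟩
      rw [graphGen_snd ⟨hl.1, by have := hl.2; have := hj.2; omega⟩]
      exact congrArg (D.quotMap j hj) (Subtype.ext (H.lowerHom_transport l hl))
    intro u hu hu0
    obtain ⟨a, rfl⟩ := hle hu
    have ha : a = 0 := (H.pred hj2 hj.2).inj (hu0.trans (map_zero _).symm)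
    rw [ha]
    exact map_zero φ
  | succ m hm ih =>
    have ih := ih (by omega)
    intro u hu hu0
    have hw : ∀ c ∈ lowerAlg K (D.graphGen j hj) m, ∃ c' ∈ lowerAlg K (D.graphGen j hj) m,
        D.graphGen j hj m * c = c' * D.graphGen j hj m := by
      intro c hc
      refine exists_mul_eq_mul_of_adjoin (K := K) ?_ hc
      rintro _ ⟨i, hi, rfl⟩
      exact ⟨_, H.graphGen_comm hj2 hm (by omega) hi⟩
    obtain ⟨p, hp, rfl⟩ := exists_eval_eq_of_adjoin (w := D.graphGen j hj m) (by
      rintro _ ⟨i, hi, rfl⟩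
      rcases (Nat.lt_succ_iff.1 hi.2).eq_or_lt with rfl | him
      · exact Set.mem_insert _ _
      · exact Set.mem_insert_of_mem _ (mem_lowerAlg K _ ⟨hi.1, him⟩)) hw hu
    have hfst : ∀ c ∈ lowerAlg K (D.graphGen j hj) m, c.1 ∈ lowerAlg K (D.gens j) m := by
      intro c hc
      have : lowerAlg K (D.graphGen j hj) m ≤
          (lowerAlg K (D.gens j) m).comap (AlgHom.fst K F (D.Quot j hj)) := by
        refine Algebra.adjoin_le ?_
        rintro _ ⟨i, hi, rfl⟩
        exact mem_lowerAlg K (D.gens j) hi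
      exact this hc
    have hz := H.free_pred hj2 hj.2 hm (by omega) (p.map (RingHom.fst F (D.Quot j hj)))
      (fun k => by rw [Polynomial.coeff_map]; exact hfst _ (hp k)) (by
        rw [Polynomial.eval_map]
        exact (Polynomial.eval₂_at_apply (RingHom.fst F (D.Quot j hj)) _).trans hu0)
    have hp0 : p = 0 := by
      ext1 k
      refine ih _ (hp k) ?_
      have := congrArg (fun r => Polynomial.coeff r k) hz
      rwa [Polynomial.coeff_map, Polynomial.coeff_zero] at this
    rw [hp0, Polynomial.eval_zero]

theorem exists_isPullbackHom : ∃ g : D.alg j →ₐ[K] D.Quot j hj, D.IsPullbackHom j hj g := by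
  obtain ⟨g, hg⟩ := exists_algHom_of_graph (C := D.alg j) (w := D.graphGen j hj)
    (S := Set.Ico 1 (N + 1)) (D.alg_eq_lowerAlg j)
    (H.eq_zero_of_graphGen hj2 (by have := hj.2; omega) le_rfl)
  refine ⟨g, fun i hi => ?_⟩
  rw [hg i ⟨hi.1, Nat.lt_succ_iff.2 hi.2⟩ _ rfl, graphGen_snd hi]
  rfl

end IsLevel

namespace IsPullbackHom

theorem unique {g g' : D.alg j →ₐ[K] D.Quot j hj} (h : D.IsPullbackHom j hj g)
    (h' : D.IsPullbackHom j hj g') : g = g' := by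
  refine AlgHom.adjoin_ext ?_
  rintro _ ⟨i, hi, rfl⟩
  exact (h i hi).trans (h' i hi).symm

theorem surjective {g : D.alg j →ₐ[K] D.Quot j hj} (h : D.IsPullbackHom j hj g) :
    Function.Surjective g := by
  have key : ∀ (a : F) (ha : a ∈ D.alg (j + 1)), D.quotMap j hj ⟨a, ha⟩ ∈ g.range := by
    intro a ha
    have hle : D.alg (j + 1) ≤ (g.range.comap (D.quotMap j hj)).map (D.alg (j + 1)).val := by
      refine Algebra.adjoin_le ?_
      rintro _ ⟨i, hi, rfl⟩
      exact ⟨D.gen (j + 1) i hi, ⟨D.gen j i hi, h i hi⟩, rfl⟩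
    obtain ⟨b, hb, e⟩ := hle ha
    have hb' : b = ⟨a, ha⟩ := Subtype.ext e
    rw [← hb']
    exact hb
  intro y
  obtain ⟨⟨a, ha⟩, rfl⟩ := D.quotMap_surjective j hj y
  exact key a ha

theorem map_gen {g : D.alg j →ₐ[K] D.Quot j hj} (h : D.IsPullbackHom j hj g) :
    g (D.gen j j hj) = 0 := (h j hj).trans (D.quotMap_gen j hj)

end IsPullbackHom

end Pullback

/-! ## The common localization -/

section Localization

variable (D) in
/-- The localization of `A^{(j)}`, and of `A^{(j+1)}`, at the powers of `x_j`. -/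
noncomputable def locAlg (j : ℕ) : Subalgebra K F :=
  Algebra.adjoin K (insert (D.gens (j + 1) j)⁻¹ (D.alg j : Set F))

variable (D) in
theorem gens_succ_mem_alg {j : ℕ} (hj1 : 1 ≤ j) (hjN : j ≤ N) : D.gens (j + 1) j ∈ D.alg j := by
  rw [← D.gens_eq_of_le hjN le_rfl]
  exact D.gens_mem j ⟨hj1, hjN⟩

namespace IsLevel

variable {j : ℕ} {θ : lowerAlg K D.X (j + 1) →ₐ[K] F} (H : D.IsLevel (j + 1) θ)
  (hj2 : 2 ≤ j) (hjN : j ≤ N)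
include H hj2 hjN

theorem exists_smul_comm_gens {i : ℕ} (hi : i ∈ Set.Icc 1 N) : ∃ c : K, c ≠ 0 ∧
    D.gens (j + 1) j * D.gens j i = c • (D.gens j i * D.gens (j + 1) j) := by
  rw [← D.gens_eq_of_le hjN le_rfl]
  rcases lt_trichotomy i j with hij | rfl | hij
  · exact ⟨_, lam_ne_zero ⟨by omega, hjN⟩ hi, H.comm_pred hj2 hjN le_rfl hjN ⟨hi.1, hij⟩⟩
  · exact ⟨1, one_ne_zero, (one_smul _ _).symm⟩
  · have h0 : D.lam i j ≠ 0 := lam_ne_zero hi ⟨by omega, hjN⟩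
    exact ⟨_, inv_ne_zero h0,
      mul_eq_inv_smul h0 (H.comm_pred hj2 hjN hij.le hi.2 ⟨by omega, hij⟩)⟩

/-- After the deletion `x_j` commutes up to nonzero scalars with every generator, so it normalises
`A^{(j)}` and its powers can be collected on either side. -/
theorem isPowLocalization : IsPowLocalization (D.alg j) (D.locAlg j) (D.gens (j + 1) j) where
  le _ ha := Algebra.subset_adjoin (Set.mem_insert_of_mem _ ha)
  x_ne_zero := H.gens_ne_zero hj2 hjN
  x_mem := D.gens_succ_mem_alg (by omega) hjN
  inv_mem := Algebra.subset_adjoin (Set.mem_insert _ _)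
  exists_pow_mul_mem _ ht := by
    refine exists_pow_mul_mem_of_mem_adjoin_inv (H.gens_ne_zero hj2 hjN)
      (D.gens_succ_mem_alg (by omega) hjN)
      (fun u hu => exists_mul_eq_mul_of_adjoin (K := K) ?_ hu) ht
    rintro _ ⟨i, hi, rfl⟩
    obtain ⟨c, _, e⟩ := H.exists_smul_comm_gens hj2 hjN hi
    exact ⟨c, e⟩
  exists_mul_pow_mem _ ht := by
    refine exists_mul_pow_mem_of_mem_adjoin_inv (H.gens_ne_zero hj2 hjN)
      (D.gens_succ_mem_alg (by omega) hjN)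
      (fun u hu => exists_mul_eq_mul_of_adjoin' (K := K) ?_ hu) ht
    rintro _ ⟨i, hi, rfl⟩
    obtain ⟨c, hc, e⟩ := H.exists_smul_comm_gens hj2 hjN hi
    exact ⟨c⁻¹, mul_eq_inv_smul hc e⟩

/-- The old variables are recovered from the new ones and `x_j⁻¹` by `mem_of_deletionMap_mem`.
Conversely, denominators are cleared in two stages, first into `A^{(j)}` and then into `A^{(j+1)}`.
-/
theorem isPowLocalization_succ :
    IsPowLocalization (D.alg (j + 1)) (D.locAlg j) (D.gens (j + 1) j) := by
  have h := H.isPowLocalization hj2 hjN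
  have h' := H.isDeletionDatum hj2 hjN
  have hx : D.gens (j + 1) j ∈ D.alg (j + 1) := D.gens_mem (j + 1) ⟨by omega, hjN⟩
  refine ⟨?_, h.x_ne_zero, hx, h.inv_mem, ?_, ?_⟩
  · refine Algebra.adjoin_le ?_
    rintro _ ⟨i, hi, rfl⟩
    rcases lt_or_ge i j with hij | hij
    · have e := H.lowerHom_transport i ⟨hi.1, hij⟩
      rw [← e]
      refine h'.mem_of_deletionMap_mem (fun a => h.le ?_) h.inv_mem _
      rw [D.alg_eq_lowerAlg]
      refine lowerAlg_mono K _ (show j ≤ N + 1 by omega) ?_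
      rw [← (H.deletionHom_transport hj2 hjN).range_eq]
      exact ⟨a, rfl⟩
    · rw [← D.gens_eq_of_le hjN hij]
      exact h.le (D.gens_mem j hi)
  · intro t ht
    obtain ⟨n, hn⟩ := h.exists_pow_mul_mem t ht
    rw [D.alg_eq_lowerAlg] at hn
    obtain ⟨m, hm⟩ := H.exists_pow_mul_mem hj2 hjN (by omega) le_rfl hn
    refine ⟨m + n, ?_⟩
    rw [D.alg_eq_lowerAlg, pow_add, mul_assoc]
    exact hm
  · intro t ht
    obtain ⟨n, hn⟩ := h.exists_mul_pow_mem t ht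
    rw [D.alg_eq_lowerAlg] at hn
    obtain ⟨m, hm⟩ := H.exists_mul_pow_mem hj2 hjN (by omega) le_rfl hn
    refine ⟨n + m, ?_⟩
    rw [D.alg_eq_lowerAlg, pow_add, ← mul_assoc]
    exact hm

end IsLevel

end Localization

/-! ## The maps `ψ_j` -/

section StepMap

variable {j : ℕ} {hj : j ∈ Set.Icc 1 N} {T : Subalgebra K F}

/-- This identifies `P S_j^{-1} ∩ A^{(j)}` with a contraction from the common localization, when `P`
is itself contracted from there. -/
theorem incl_mem_iff (h0 : IsPowLocalization (D.alg j) T (D.gens (j + 1) j))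
    (h1 : IsPowLocalization (D.alg (j + 1)) T (D.gens (j + 1) j)) (z : CSpec T) (a : D.alg j) :
    h0.incl a ∈ z.1 ↔ ∃ p ∈ (cspecComap h1.incl z).1, ∃ n : ℕ,
      (a : F) = (p : F) * (D.gens (j + 1) j ^ n)⁻¹ := by
  constructor
  · intro ha
    obtain ⟨n, hn⟩ := h1.exists_mul_pow_mem a (h0.le a.2)
    refine ⟨⟨_, hn⟩, mem_cspecComap.2 ?_, n, ?_⟩
    · have e : h1.incl ⟨_, hn⟩ = h0.incl a * (h1.unit ^ n : Tˣ) := Subtype.ext (by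
        rw [Subalgebra.coe_mul, h1.coe_unit_pow]
        rfl)
      rw [e]
      exact (mul_unit_mem_cspec_iff z _).2 ha
    · rw [mul_inv_cancel_right₀ (pow_ne_zero n h0.x_ne_zero)]
  · rintro ⟨p, hp, n, e⟩
    rw [← mul_unit_mem_cspec_iff z (h1.unit ^ n)]
    have e' : h0.incl a * (h1.unit ^ n : Tˣ) = h1.incl p := Subtype.ext (by
      rw [Subalgebra.coe_mul, h1.coe_unit_pow, h0.coe_incl, h1.coe_incl, e,
        inv_mul_cancel_right₀ (pow_ne_zero n h0.x_ne_zero)])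
    rw [e']
    exact mem_cspecComap.1 hp

theorem pullback_mem_iff (g : D.alg j →ₐ[K] D.Quot j hj) (z : CSpec (D.Quot j hj))
    (a : D.alg j) : g a ∈ z.1 ↔
      ∃ p ∈ (cspecComap (D.quotMap j hj : D.alg (j + 1) →+* D.Quot j hj) z).1,
        g a = (D.varIdeal j hj).ringCon.mk' p := by
  constructor
  · intro ha
    obtain ⟨p, hp⟩ := D.quotMap_surjective j hj (g a)
    refine ⟨p, mem_cspecComap.2 ?_, hp.symm⟩
    exact hp.symm ▸ ha
  · rintro ⟨p, hp, e⟩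
    rw [e]
    exact mem_cspecComap.1 hp

theorem range_cspecComap_quotMap :
    Set.range (cspecComap (D.quotMap j hj : D.alg (j + 1) →+* D.Quot j hj)) =
      cspecPiece (D.gen (j + 1) j hj) 1 := by
  ext P
  rw [mem_range_cspecComap_of_surjective (f := (D.quotMap j hj : D.alg (j + 1) →+* D.Quot j hj))
    (D.quotMap_surjective j hj)]
  have h1 : P ∈ cspecPiece (D.gen (j + 1) j hj) 1 ↔ D.gen (j + 1) j hj ∈ P.1 := by
    simp [cspecPiece]
  rw [h1]
  constructor
  · exact fun h => h _ (D.quotMap_gen j hj)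
  · intro h a ha
    have hle : D.varIdeal j hj ≤ P.1 := TwoSidedIdeal.span_le.2 (Set.singleton_subset_iff.2 h)
    exact hle ((D.quotMap_eq_zero_iff j hj a).1 ha)

namespace IsStepMap

variable {ψ : CSpec (D.alg (j + 1)) → CSpec (D.alg j)} (hψ : D.IsStepMap j hj ψ)

theorem unique {ψ' : CSpec (D.alg (j + 1)) → CSpec (D.alg j)} (hψ : D.IsStepMap j hj ψ)
    (hψ' : D.IsStepMap j hj ψ') : ψ = ψ' := by
  funext P
  refine cspec_ext fun a => ?_
  by_cases hx : D.gen (j + 1) j hj ∈ P.1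
  · obtain ⟨g, hg, h⟩ := hψ.of_mem P hx
    obtain ⟨g', hg', h'⟩ := hψ'.of_mem P hx
    rw [h, h', hg.unique hg']
  · rw [hψ.of_notMem P hx, hψ'.of_notMem P hx]

include hψ

theorem map_incl (h0 : IsPowLocalization (D.alg j) T (D.gens (j + 1) j))
    (h1 : IsPowLocalization (D.alg (j + 1)) T (D.gens (j + 1) j)) (z : CSpec T) :
    ψ (cspecComap h1.incl z) = cspecComap h0.incl z := by
  refine cspec_ext fun a => ?_
  rw [hψ.of_notMem _ (fun hx => unit_notMem_cspec z h1.unit (mem_cspecComap.1 hx)),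
    mem_cspecComap, incl_mem_iff h0 h1]

theorem map_quot {g : D.alg j →ₐ[K] D.Quot j hj} (hg : D.IsPullbackHom j hj g)
    (z : CSpec (D.Quot j hj)) :
    ψ (cspecComap (D.quotMap j hj : D.alg (j + 1) →+* D.Quot j hj) z) =
      cspecComap (g : D.alg j →+* D.Quot j hj) z := by
  refine cspec_ext fun a => ?_
  obtain ⟨g', hg', h⟩ := hψ.of_mem (cspecComap (D.quotMap j hj : D.alg (j + 1) →+* D.Quot j hj) z)
    (mem_cspecComap.2 (by
      rw [AlgHom.coe_toRingHom, quotMap_gen]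
      exact z.1.zero_mem))
  rw [h, hg'.unique hg, mem_cspecComap]
  exact (pullback_mem_iff g z a).symm

end IsStepMap

open Classical in
-- Every `P` is contracted from the localization or from the quotient. Contracting the same prime to
-- `A^{(j)}` gives a completely prime ideal with no further verification.
theorem exists_isStepMap (h0 : IsPowLocalization (D.alg j) T (D.gens (j + 1) j))
    (h1 : IsPowLocalization (D.alg (j + 1)) T (D.gens (j + 1) j))
    {g : D.alg j →ₐ[K] D.Quot j hj} (hg : D.IsPullbackHom j hj g) :
    ∃ ψ, D.IsStepMap j hj ψ := by
  have hr0 : ∀ P : CSpec (D.alg (j + 1)), D.gen (j + 1) j hj ∉ P.1 →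
      ∃ z, cspecComap h1.incl z = P := by
    intro P hP
    have : P ∈ Set.range (cspecComap h1.incl) := by
      rw [h1.range_cspecComap_incl]
      exact iff_of_false hP (by simp)
    exact this
  have hr1 : ∀ P : CSpec (D.alg (j + 1)), D.gen (j + 1) j hj ∈ P.1 →
      ∃ z, cspecComap (D.quotMap j hj : D.alg (j + 1) →+* D.Quot j hj) z = P := by
    intro P hP
    have : P ∈ Set.range (cspecComap (D.quotMap j hj : D.alg (j + 1) →+* D.Quot j hj)) := by
      rw [range_cspecComap_quotMap]
      exact iff_of_true hP rfl
    exact this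
  choose z₀ hz₀ using hr0
  choose z₁ hz₁ using hr1
  refine ⟨fun P => if hP : D.gen (j + 1) j hj ∈ P.1 then
    cspecComap (g : D.alg j →+* D.Quot j hj) (z₁ P hP) else cspecComap h0.incl (z₀ P hP), ?_, ?_⟩
  · intro P hP a
    rw [dif_neg hP, mem_cspecComap, incl_mem_iff h0 h1, hz₀]
  · intro P hP
    refine ⟨g, hg, fun a => ?_⟩
    rw [dif_pos hP, mem_cspecComap]
    refine (pullback_mem_iff g _ a).trans ?_
    rw [hz₁]

end StepMap

end QuantumNilpotent

/-! ### The two strata and injectivity -/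

namespace QuantumNilpotent

variable {K F : Type*} [Field K] [DivisionRing F] [Algebra K F] {N : ℕ}
  {D : QuantumNilpotent K F N} {j : ℕ} {hj : j ∈ Set.Icc 1 N}

/-- `ψ` restricts to an isomorphism of ordered spaces from `𝒫^ε(A^{(j+1)})` onto a closed subset of
`𝒫^ε(A^{(j)})`. -/
def IsPieceEmbedding (j : ℕ) (hj : j ∈ Set.Icc 1 N) (ψ : CSpec (D.alg (j + 1)) → CSpec (D.alg j))
    (ε : Fin 2) : Prop :=
  (∃ e : cspecPiece (D.gen (j + 1) j hj) ε ≃ₜ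
      (ψ '' cspecPiece (D.gen (j + 1) j hj) ε : Set (CSpec (D.alg j))),
    (∀ P, (e P : CSpec (D.alg j)) = ψ P) ∧ ∀ P P', e P ≤ e P' ↔ P ≤ P') ∧
  ψ '' cspecPiece (D.gen (j + 1) j hj) ε ⊆ cspecPiece (D.gen j j hj) ε ∧
  IsClosed ((↑) ⁻¹' (ψ '' cspecPiece (D.gen (j + 1) j hj) ε) : Set (cspecPiece (D.gen j j hj) ε))

/-- One criterion serves both strata, with `B` the common localization or the quotient. The image is
a closed set `V` intersected with the stratum, hence closed in it. -/
theorem isPieceEmbedding_of_embeddings {B : Type*} [Ring B]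
    {ψ : CSpec (D.alg (j + 1)) → CSpec (D.alg j)} {ε : Fin 2} {f : D.alg (j + 1) →+* B}
    {g : D.alg j →+* B} (hf : IsSurjectiveUpToUnits f)
    (hg : IsSurjectiveUpToUnits g) (h : ∀ z, ψ (cspecComap f z) = cspecComap g z)
    (hfr : Set.range (cspecComap f) = cspecPiece (D.gen (j + 1) j hj) ε)
    {V : Set (CSpec (D.alg j))} (hV : IsClosed V)
    (hgr : Set.range (cspecComap g) = V ∩ cspecPiece (D.gen j j hj) ε) :
    IsPieceEmbedding j hj ψ ε := by
  have him : ψ '' cspecPiece (D.gen (j + 1) j hj) ε = V ∩ cspecPiece (D.gen j j hj) ε := by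
    rw [← hfr, ← hgr, ← Set.range_comp]
    exact congrArg Set.range (funext h)
  refine ⟨?_, him ▸ Set.inter_subset_right, ?_⟩
  · exact exists_homeomorph_of_embeddings hf.isEmbedding_cspecComap hg.isEmbedding_cspecComap
      (fun _ _ => hf.cspecComap_le_iff) (fun _ _ => hg.cspecComap_le_iff) h hfr
  · rw [him, Set.preimage_inter, Subtype.coe_preimage_self, Set.inter_univ]
    exact hV.preimage continuous_subtype_val

namespace IsLevel

variable {θ : lowerAlg K D.X (j + 1) →ₐ[K] F} {ψ : CSpec (D.alg (j + 1)) → CSpec (D.alg j)}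

theorem isPieceEmbedding (H : D.IsLevel (j + 1) θ) (hj2 : 2 ≤ j) (hψ : D.IsStepMap j hj ψ)
    (ε : Fin 2) : IsPieceEmbedding j hj ψ ε := by
  have hgen : (⟨D.gens (j + 1) j, D.gens_succ_mem_alg hj.1 hj.2⟩ : D.alg j) = D.gen j j hj :=
    Subtype.ext (D.gens_eq_of_le hj.2 le_rfl).symm
  obtain rfl | rfl : ε = 0 ∨ ε = 1 := by omega
  · have h0 := H.isPowLocalization hj2 hj.2
    have h1 := H.isPowLocalization_succ hj2 hj.2
    refine isPieceEmbedding_of_embeddings h1.isSurjectiveUpToUnits h0.isSurjectiveUpToUnits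
      (hψ.map_incl h0 h1) h1.range_cspecComap_incl isClosed_univ ?_
    rw [Set.univ_inter, h0.range_cspecComap_incl, hgen]
  · obtain ⟨g, hg⟩ := H.exists_isPullbackHom (hj := hj) hj2
    have hs : Function.Surjective (g : D.alg j →+* D.Quot j hj) := hg.surjective
    have hq : Function.Surjective (D.quotMap j hj : D.alg (j + 1) →+* D.Quot j hj) :=
      D.quotMap_surjective j hj
    refine isPieceEmbedding_of_embeddings hq.isSurjectiveUpToUnits hs.isSurjectiveUpToUnits
      (hψ.map_quot hg) range_cspecComap_quotMap
      (isClosed_cspec_iff.2 ⟨{a : D.alg j | g a = 0}, rfl⟩) ?_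
    ext P
    rw [mem_range_cspecComap_of_surjective hs]
    -- Since `g` kills `y_j`, primes containing `ker g` lie in the stratum `ε = 1` already.
    exact ⟨fun h => ⟨h, iff_of_true (h _ hg.map_gen) rfl⟩, fun h => h.1⟩

end IsLevel

/-- The stratum of `ψ P` is that of `P`, so two primes with the same image lie in one stratum, where
`ψ` is injective. -/
theorem injective_of_isPieceEmbedding {ψ : CSpec (D.alg (j + 1)) → CSpec (D.alg j)}
    (h : ∀ ε, IsPieceEmbedding j hj ψ ε) : Function.Injective ψ := by
  have hε : ∀ P : CSpec (D.alg (j + 1)), ∃ ε, P ∈ cspecPiece (D.gen (j + 1) j hj) ε := by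
    intro P
    by_cases hP : D.gen (j + 1) j hj ∈ P.1
    · exact ⟨1, iff_of_true hP rfl⟩
    · exact ⟨0, iff_of_false hP (by simp)⟩
  intro P P' e
  obtain ⟨ε, hP⟩ := hε P
  obtain ⟨ε', hP'⟩ := hε P'
  have h1 : ψ P ∈ cspecPiece (D.gen j j hj) ε := (h ε).2.1 (Set.mem_image_of_mem ψ hP)
  have h2 : ψ P' ∈ cspecPiece (D.gen j j hj) ε' := (h ε').2.1 (Set.mem_image_of_mem ψ hP')
  rw [e] at h1
  have h3 : ε = 1 ↔ ε' = 1 := h1.symm.trans h2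
  obtain rfl : ε = ε' := by omega
  obtain ⟨f, hf, -⟩ := (h ε).1
  have h4 : f ⟨P, hP⟩ = f ⟨P', hP'⟩ := Subtype.ext (by rw [hf, hf]; exact e)
  exact congrArg Subtype.val (f.injective h4)

theorem composite_injective {ψ : ∀ j : ℕ, CSpec (D.alg (j + 1)) → CSpec (D.alg j)} {m : ℕ}
    (h : ∀ j, 2 ≤ j → j ≤ m + 1 → Function.Injective (ψ j)) :
    Function.Injective (D.composite ψ m) := by
  induction m with
  | zero => exact Function.injective_id
  | succ m ih =>
    exact (ih fun j h1 h2 => h j h1 (by omega)).comp (h (m + 2) (by omega) le_rfl)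

end QuantumNilpotent

/-- Here `N = n + 1 ≥ 1` is the number of generators, `A = A^{(n+2)}` and `A' = A^{(2)}`. -/
theorem proposition3p4 {K F : Type*} [Field K] [DivisionRing F] [Algebra K F] {n : ℕ}
    (D : QuantumNilpotent K F (n + 1)) :
    -- the change of variables, the maps `g_j` and the maps `ψ_j` are well defined
    (∀ (j : ℕ) (hj : j ∈ Set.Icc 1 (n + 1)), 2 ≤ j →
      D.gens (j + 1) j ≠ 0 ∧
      (∃! θ : lowerAlg K D.X j →ₐ[K] F, D.IsTransport j (D.gens (j + 1)) θ) ∧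
      (∃! g : D.alg j →ₐ[K] D.Quot j hj, D.IsPullbackHom j hj g) ∧
      (∀ g : D.alg j →ₐ[K] D.Quot j hj, D.IsPullbackHom j hj g → Function.Surjective g) ∧
      (∃! ψ : CSpec (D.alg (j + 1)) → CSpec (D.alg j), D.IsStepMap j hj ψ)) ∧
    -- properties of the maps `ψ_j` and of the canonical embedding `ψ = ψ_2 ∘ ⋯ ∘ ψ_N`
    (∀ ψ : ∀ j : ℕ, CSpec (D.alg (j + 1)) → CSpec (D.alg j),
      (∀ (j : ℕ) (hj : j ∈ Set.Icc 1 (n + 1)), 2 ≤ j → D.IsStepMap j hj (ψ j)) →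
      (∀ (j : ℕ) (hj : j ∈ Set.Icc 1 (n + 1)), 2 ≤ j →
        Function.Injective (ψ j) ∧
        ∀ ε : Fin 2,
          (∃ e : cspecPiece (D.gen (j + 1) j hj) ε ≃ₜ
              (ψ j '' cspecPiece (D.gen (j + 1) j hj) ε : Set (CSpec (D.alg j))),
            (∀ P, (e P : CSpec (D.alg j)) = ψ j P) ∧ ∀ P P', e P ≤ e P' ↔ P ≤ P') ∧
          ψ j '' cspecPiece (D.gen (j + 1) j hj) ε ⊆ cspecPiece (D.gen j j hj) ε ∧
          IsClosed ((↑) ⁻¹' (ψ j '' cspecPiece (D.gen (j + 1) j hj) ε) :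
            Set (cspecPiece (D.gen j j hj) ε))) ∧
      Function.Injective (D.composite ψ n)) := by
  have level : ∀ j, j ∈ Set.Icc 1 (n + 1) → ∃ θ, D.IsLevel (j + 1) θ := fun j hj =>
    D.exists_isLevel (by have := hj.1; omega) (by have := hj.2; omega)
  constructor
  · intro j hj hj2
    obtain ⟨θ, H⟩ := level j hj
    obtain ⟨g, hg⟩ := H.exists_isPullbackHom (hj := hj) hj2
    obtain ⟨ψ, hψ⟩ := QuantumNilpotent.exists_isStepMap (H.isPowLocalization hj2 hj.2)
      (H.isPowLocalization_succ hj2 hj.2) hg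
    exact ⟨H.gens_ne_zero hj2 hj.2,
      ⟨_, H.lowerHom_transport, fun _ h => h.unique H.lowerHom_transport⟩,
      ⟨g, hg, fun _ h => h.unique hg⟩, fun _ h => h.surjective,
      ⟨ψ, hψ, fun _ h => h.unique hψ⟩⟩
  · intro ψ hψ
    have hpiece : ∀ (j : ℕ) (hj : j ∈ Set.Icc 1 (n + 1)), 2 ≤ j →
        ∀ ε, QuantumNilpotent.IsPieceEmbedding j hj (ψ j) ε := fun j hj hj2 ε => by
      obtain ⟨θ, H⟩ := level j hj
      exact H.isPieceEmbedding hj2 (hψ j hj hj2) ε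
    have hinj : ∀ (j : ℕ) (hj : j ∈ Set.Icc 1 (n + 1)), 2 ≤ j → Function.Injective (ψ j) :=
      fun j hj hj2 => QuantumNilpotent.injective_of_isPieceEmbedding (hpiece j hj hj2)
    exact ⟨fun j hj hj2 => ⟨hinj j hj hj2, hpiece j hj hj2⟩,
      QuantumNilpotent.composite_injective fun j h1 h2 => hinj j ⟨by omega, h2⟩ h1⟩
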